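/- **Conventions.** All locally convex spaces are real or complex and Hausdorff. Let $E,F$ be locally convex spaces and let $U\subseteq E$ have dense interior. A map $f\colon U\to F$ is $C^1$ if it is continuous, if the limit $df(x).v=\lim_{h\to 0}\frac1h\,(f(x+hv)-f(x))$ ($h$ real) exists for all $x\in\operatorname{int}U$ and $v\in E$, and if $(x,v)\mapsto df(x).v$ extends to a continuous map $df\colon U\times E\to F$. It is *smooth* if the higher differentials $d^0f=f$, $d^{n+1}f=d(d^nf)\colon U\times E^{2^{n+1}-1}\to F$ exist for all $n$. If $E,F$ are complex, a smooth map $f$ is *holomorphic* if $df(x)\colon E\to F$ is complex linear for all $x\in\operatorname{int}U$. A *smooth manifold with corners* is a Hausdorff space $M$ with charts (homeomorphisms $\varphi$ from open subsets of $M$ onto relatively open subsets of $X^+=\{x\in X:\lambda_1(x)\ge 0,\dots,\lambda_k(x)\ge 0\}$) that cover $M$ and whose coordinate changes are smooth; here $X$ is a locally convex space and $\lambda_1,\dots,\lambda_k$ are continuous linear functionals on $X$ such that $X^+$ has dense interior. A map from $M$ to $F$, or from $M\times U$ to $F$ with $U\subseteq E$ open, is smooth if its coordinate representations with respect to the charts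 $\varphi$ of $M$ (respectively $\varphi\times\operatorname{id}_U$ of $M\times U$) are smooth. The space $C^\infty(M,F)$ of smooth maps carries the topology of compact convergence of all differentials $d^n\gamma$ on $T^nM$, i.e. the initial topology with respect to the maps $\gamma\mapsto d^n(\gamma\circ\varphi^{-1})\in C(\varphi(U_\varphi)\times X^{2^n-1},F)$ for all charts $\varphi$ (with domain $U_\varphi$) and all $n\ge 0$, where the spaces $C(\cdot,F)$ carry the compact-open topology. Put $C^\infty(M,U)=\{\gamma\in C^\infty(M,E):\gamma(M)\subseteq U\}$. **Proposition.** Let $M$ be a compact smooth manifold with corners, let $E$ and $F$ be locally convex spaces and let $U\subseteq E$ be open. Then $C^\infty(M,U)$ is open in $C^\infty(M,E)$. If $f\colon M\times U\to F$ is smooth, then $f\circ(\operatorname{id}_M,\gamma)$ is smooth for each $\gamma\in C^\infty(M,U)$, and the map $$f_\sharp\colon C^\infty(M,U)\to C^\infty(M,F),\qquad \gamma\mapsto f\circ(\operatorname{id}_M,\gamma),$$ is smooth. For all $n\in\mathbb N_0$ its $n$-th differential is $d^n(f_\sharp)=(d_2^nf)_\sharp$, that is, $$d^n(f_\sharp)(w)(x)=d_2^nf\big(x,w(x)\big)\qquad\text{for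 } w\in C^\infty(M,U)\times C^\infty(M,E)^{2^n-1},\ x\in M,$$ where $w(x)\in U\times E^{2^n-1}$ is obtained by evaluating each component at $x$, and where $d_2^nf\colon M\times(U\times E^{2^n-1})\to F$ is the $n$-th differential of $f$ with all tangent directions along $M$ equal to zero: $d_2^nf(x,w)=d^n\big(f\circ(\varphi^{-1}\times\operatorname{id}_U)\big)\big((\varphi(x),0,\dots,0),w\big)$ for each chart $\varphi$ of $M$ around $x$. If, moreover, $E$ and $F$ are complex and $f(m,\cdot)\colon U\to F$ is holomorphic for all $m\in M$, then $f_\sharp$ is holomorphic. **Corollary.** If $M$ is a compact smooth manifold with corners, $U\subseteq E$ is open and $g\colon U\to F$ is smooth (respectively holomorphic), then $g\circ\gamma\in C^\infty(M,F)$ for each $\gamma\in C^\infty(M,U)$, and the push-forward $g_*\colon C^\infty(M,U)\to C^\infty(M,F)$, $\gamma\mapsto g\circ\gamma$, is smooth (respectively holomorphic). -/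

import Mathlib

open Set Filter Topology

noncomputable section

/-! ### Iterated tangent spaces of a vector space -/

/-- `T^n E = E^(2^n)`, as iterated pairs: `T^(n+1) E = T^n E × T^n E`. -/
def IterTan.{u} : ℕ → Type u → Type u
  | 0, E => E
  | n + 1, E => IterTan n E × IterTan n E

namespace IterTan

instance instAddCommGroup (E : Type*) [AddCommGroup E] : (n : ℕ) → AddCommGroup (IterTan n E)
  | 0 => inferInstanceAs (AddCommGroup E)
  | n + 1 =>
    letI := instAddCommGroup E n
    inferInstanceAs (AddCommGroup (IterTan n E × IterTan n E))

instance instModule (E : Type*) [AddCommGroup E] [Module ℝ E] : (n : ℕ) → Module ℝ (IterTan n E)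
  | 0 => inferInstanceAs (Module ℝ E)
  | n + 1 =>
    letI := instModule E n
    inferInstanceAs (Module ℝ (IterTan n E × IterTan n E))

instance instTopologicalSpace (E : Type*) [TopologicalSpace E] :
    (n : ℕ) → TopologicalSpace (IterTan n E)
  | 0 => inferInstanceAs (TopologicalSpace E)
  | n + 1 =>
    letI := instTopologicalSpace E n
    inferInstanceAs (TopologicalSpace (IterTan n E × IterTan n E))

/-- The subset `U × E^(2^n-1)` of `T^n E`: the base point lies in `U`, all other components are
arbitrary. -/
def tanOver {E : Type*} (U : Set E) : (n : ℕ) → Set (IterTan n E)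
  | 0 => U
  | n + 1 => (tanOver U n ×ˢ univ : Set (IterTan n E × IterTan n E))

/-- Apply a map to each of the `2^n` components. -/
def map {E F : Type*} (φ : E → F) : (n : ℕ) → IterTan n E → IterTan n F
  | 0, w => φ w
  | n + 1, w => (map φ n w.1, map φ n w.2)

/-- The element `(x, 0, …, 0)` of `T^n E`. -/
def zeroAt {E : Type*} [AddCommGroup E] (x : E) : (n : ℕ) → IterTan n E
  | 0 => x
  | n + 1 => (zeroAt x n, (0 : IterTan n E))

/-- The identification `T^n X × T^n E = T^n (X × E)`, componentwise. -/
def zip {X E : Type*} : (n : ℕ) → IterTan n X → IterTan n E → IterTan n (X × E)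
  | 0, a, b => ((a, b) : X × E)
  | n + 1, a, b => (zip n a.1 b.1, zip n a.2 b.2)

end IterTan

/-! ### Differential calculus on subsets with dense interior -/

section Calculus

variable {E F : Type*} [AddCommGroup E] [Module ℝ E] [TopologicalSpace E]
  [AddCommGroup F] [Module ℝ F] [TopologicalSpace F]

/-- `f` is `C¹` on `U` with differential `f'`: `f` is continuous on `U`, at every interior point `x`
and for every `v` the directional derivative exists and equals `f' (x, v)`, and `f'` is continuous
on `U × E`. Only the values of `f` on `U` and of `f'` on `U × E` matter. -/
structure HasDiffOn (f : E → F) (f' : E × E → F) (U : Set E) : Prop where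
  continuousOn : ContinuousOn f U
  tendsto : ∀ x ∈ interior U, ∀ v : E,
    Tendsto (fun h : ℝ => h⁻¹ • (f (x + h • v) - f x)) (𝓝[≠] 0) (𝓝 (f' (x, v)))
  continuousOn_diff : ContinuousOn f' (U ×ˢ univ)

/-- `g` is a sequence of higher differentials of `f` on `U`: `g 0 = f`, and `g (n+1)` is the
differential of `g n` on `U × E^(2^n-1)`. -/
structure IsDiffTower (f : E → F) (U : Set E) (g : (n : ℕ) → IterTan n E → F) : Prop where
  zero : g 0 = f
  succ : ∀ n, HasDiffOn (g n) (g (n + 1)) (IterTan.tanOver U n)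

/-- `f` is smooth on `U`: all higher differentials exist in the interior and extend continuously to
`U × E^(2^n-1)`. -/
def SmoothOn (f : E → F) (U : Set E) : Prop :=
  ∃ g : (n : ℕ) → IterTan n E → F, IsDiffTower f U g

open Classical in
/-- The `n`-th differential `dⁿf : U × E^(2^n-1) → F` of a smooth map `f` on `U`. If `U` has dense
interior and `F` is Hausdorff, it is uniquely determined on `U × E^(2^n-1)`. -/
def iterDiff (f : E → F) (U : Set E) (n : ℕ) : IterTan n E → F :=
  if h : SmoothOn f U then h.choose n else 0

/-- `f` is holomorphic on `U`: it is smooth and its differential is complex linear at each interior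
point. -/
def HolomorphicOn [Module ℂ E] [Module ℂ F] (f : E → F) (U : Set E) : Prop :=
  SmoothOn f U ∧ ∃ f' : E × E → F, HasDiffOn f f' U ∧
    ∀ x ∈ interior U, IsLinearMap ℂ (fun v => f' (x, v))

theorem SmoothOn.isDiffTower {f : E → F} {U : Set E} (h : SmoothOn f U) :
    IsDiffTower f U (iterDiff f U) := by
  have : iterDiff f U = h.choose := by
    funext n
    simp [iterDiff, h]
  rw [this]
  exact h.choose_spec

theorem SmoothOn.continuousOn_iterDiff {f : E → F} {U : Set E} (h : SmoothOn f U) (n : ℕ) :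
    ContinuousOn (iterDiff f U n) (IterTan.tanOver U n) :=
  (h.isDiffTower.succ n).continuousOn

theorem HasDiffOn.add [IsTopologicalAddGroup F] {f₁ f₂ : E → F} {g₁ g₂ : E × E → F} {U : Set E}
    (h₁ : HasDiffOn f₁ g₁ U) (h₂ : HasDiffOn f₂ g₂ U) : HasDiffOn (f₁ + f₂) (g₁ + g₂) U where
  continuousOn := h₁.continuousOn.add h₂.continuousOn
  tendsto x hx v := by
    refine ((h₁.tendsto x hx v).add (h₂.tendsto x hx v)).congr fun h => ?_
    simp only [Pi.add_apply, ← smul_add]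
    congr 1
    abel
  continuousOn_diff := h₁.continuousOn_diff.add h₂.continuousOn_diff

theorem HasDiffOn.const_smul {𝕜 : Type*} [Semiring 𝕜] [Module 𝕜 F] [SMulCommClass ℝ 𝕜 F]
    [ContinuousConstSMul 𝕜 F] (c : 𝕜) {f : E → F} {g : E × E → F} {U : Set E}
    (h : HasDiffOn f g U) : HasDiffOn (c • f) (c • g) U where
  continuousOn := h.continuousOn.const_smul c
  tendsto x hx v := by
    refine ((h.tendsto x hx v).const_smul c).congr fun t => ?_
    simp only [Pi.smul_apply]
    rw [← smul_comm, smul_sub]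
  continuousOn_diff := h.continuousOn_diff.const_smul c

theorem HasDiffOn.zero (U : Set E) : HasDiffOn (0 : E → F) (0 : E × E → F) U where
  continuousOn := continuousOn_const
  tendsto x hx v := by simpa using tendsto_const_nhds
  continuousOn_diff := continuousOn_const

theorem SmoothOn.zero (U : Set E) : SmoothOn (0 : E → F) U :=
  ⟨fun _ => 0, rfl, fun _ => HasDiffOn.zero _⟩

theorem SmoothOn.add [IsTopologicalAddGroup F] {f₁ f₂ : E → F} {U : Set E}
    (h₁ : SmoothOn f₁ U) (h₂ : SmoothOn f₂ U) : SmoothOn (f₁ + f₂) U := by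
  obtain ⟨g₁, h₁⟩ := h₁
  obtain ⟨g₂, h₂⟩ := h₂
  exact ⟨fun n => g₁ n + g₂ n, by rw [h₁.zero, h₂.zero]; rfl, fun n => (h₁.succ n).add (h₂.succ n)⟩

theorem SmoothOn.const_smul {𝕜 : Type*} [Semiring 𝕜] [Module 𝕜 F] [SMulCommClass ℝ 𝕜 F]
    [ContinuousConstSMul 𝕜 F] (c : 𝕜) {f : E → F} {U : Set E} (h : SmoothOn f U) :
    SmoothOn (c • f) U := by
  obtain ⟨g, h⟩ := h
  exact ⟨fun n => c • g n, by rw [h.zero]; rfl, fun n => (h.succ n).const_smul c⟩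

end Calculus

/-! ### Manifolds with corners -/

section Manifold

variable {X M E F : Type*} [AddCommGroup X] [Module ℝ X] [TopologicalSpace X] [TopologicalSpace M]
  [AddCommGroup E] [Module ℝ E] [TopologicalSpace E]
  [AddCommGroup F] [Module ℝ F] [TopologicalSpace F]

/-- A homeomorphism from an open subset `source` of `M` onto a relatively open subset `target` of
`P ⊆ X`. (The values of the two maps outside `source` and `target` are irrelevant.) -/
structure CornerChart (M : Type*) [TopologicalSpace M] {X : Type*} [TopologicalSpace X]
    (P : Set X) extends PartialEquiv M X where
  isOpen_source : IsOpen source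
  target_eq : ∃ O : Set X, IsOpen O ∧ target = O ∩ P
  continuousOn_toFun : ContinuousOn toFun source
  continuousOn_invFun : ContinuousOn invFun target

/-- The set `X⁺` of the points where the functionals `l 1, …, l k` are nonnegative. -/
def cornerSet {k : ℕ} (l : Fin k → X →L[ℝ] ℝ) : Set X := {x | ∀ i, 0 ≤ l i x}

/-- A differential structure with corners on `M`, modelled on `X⁺ ⊆ X`. It is not required to be
maximal; maximal ones (atlases) are a special case. -/
structure CornerStructure (X M : Type*) [AddCommGroup X] [Module ℝ X] [TopologicalSpace X]
    [TopologicalSpace M] where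
  /-- the number of functionals -/
  codim : ℕ
  /-- the functionals that cut out the model set -/
  functional : Fin codim → X →L[ℝ] ℝ
  dense_interior : cornerSet functional ⊆ closure (interior (cornerSet functional))
  /-- the charts -/
  charts : Set (CornerChart M (cornerSet functional))
  cover : ∀ m : M, ∃ e ∈ charts, m ∈ e.source
  compatible : ∀ e ∈ charts, ∀ e' ∈ charts,
    SmoothOn (fun x => e'.toFun (e.invFun x)) (e.target ∩ e.invFun ⁻¹' e'.source)

/-- `γ : M → F` is smooth: its coordinate representations are. -/
def IsSmooth (S : CornerStructure X M) (γ : M → F) : Prop :=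
  ∀ e ∈ S.charts, SmoothOn (fun x => γ (e.invFun x)) e.target

/-- The coordinate representation `(x, y) ↦ f (e⁻¹ x, y)` of a map `f` on `M × U`, with respect to
the product chart `e × id`. -/
def chartRep {P : Set X} (e : CornerChart M P) (f : M × E → F) : X × E → F :=
  fun p => f (e.invFun p.1, p.2)

/-- `f : M × U → F` is smooth on the product manifold `M × U`. -/
def IsSmoothProd (S : CornerStructure X M) (f : M × E → F) (U : Set E) : Prop :=
  ∀ e ∈ S.charts, SmoothOn (chartRep e f) (e.target ×ˢ U)

/-- `d₂ⁿf (x, w) = dⁿf ((x, 0, …, 0), w)` for `w ∈ U × E^(2^n-1)`, computed in the chart `e`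
around `x`: the `n`-th differential of `f` with all directions in `M` equal to zero. -/
def iterDiffSnd {P : Set X} (e : CornerChart M P) (f : M × E → F) (U : Set E) (n : ℕ)
    (x : M) (w : IterTan n E) : F :=
  iterDiff (chartRep e f) (e.target ×ˢ U) n (IterTan.zip n (IterTan.zeroAt (e.toFun x) n) w)

end Manifold

/-! ### The locally convex space `C^∞(M, F)` -/

section SmoothMap

variable {X M : Type*} [AddCommGroup X] [Module ℝ X] [TopologicalSpace X] [TopologicalSpace M]

/-- Smooth maps form a linear subspace of the space of all maps `M → F`. -/
def smoothSubmodule (S : CornerStructure X M) (F : Type*) [AddCommGroup F] [Module ℝ F]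
    [TopologicalSpace F] [IsTopologicalAddGroup F] [ContinuousSMul ℝ F] :
    Submodule ℝ (M → F) where
  carrier := {γ | IsSmooth S γ}
  add_mem' h₁ h₂ := fun e he => (h₁ e he).add (h₂ e he)
  zero_mem' := fun _ _ => SmoothOn.zero _
  smul_mem' c _ h := fun e he => (h e he).const_smul c

/-- The space `C^∞(M, F)`. -/
def SmoothMap (S : CornerStructure X M) (F : Type*) [AddCommGroup F] [Module ℝ F]
    [TopologicalSpace F] [IsTopologicalAddGroup F] [ContinuousSMul ℝ F] : Type _ :=
  smoothSubmodule S F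

namespace SmoothMap

variable (S : CornerStructure X M)
  {E F : Type*} [AddCommGroup E] [Module ℝ E] [TopologicalSpace E] [IsTopologicalAddGroup E]
  [ContinuousSMul ℝ E]
  [AddCommGroup F] [Module ℝ F] [TopologicalSpace F] [IsTopologicalAddGroup F]
  [ContinuousSMul ℝ F]

instance : AddCommGroup (SmoothMap S F) := inferInstanceAs (AddCommGroup (smoothSubmodule S F))

instance : Module ℝ (SmoothMap S F) := inferInstanceAs (Module ℝ (smoothSubmodule S F))

instance : CoeFun (SmoothMap S F) (fun _ => M → F) := ⟨Subtype.val⟩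

/-- Pointwise multiplication with complex scalars. -/
instance [Module ℂ F] [IsScalarTower ℝ ℂ F] [ContinuousSMul ℂ F] : SMul ℂ (SmoothMap S F) :=
  ⟨fun c γ => ⟨c • γ.1, fun e he => (γ.2 e he).const_smul c⟩⟩

/-- If `F` is complex, so is `C^∞(M, F)`. -/
instance [Module ℂ F] [IsScalarTower ℝ ℂ F] [ContinuousSMul ℂ F] : Module ℂ (SmoothMap S F) :=
  Function.Injective.module ℂ (smoothSubmodule S F).subtype.toAddMonoidHom
    Subtype.val_injective fun _ _ => rfl

variable {S}

/-- The `n`-th differential of `γ` in a chart `e`, i.e. `dⁿγ` on the chart domain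
`T^n (e.source) ≅ e.target × X^(2^n-1)` of `T^n M`. -/
def chartDiff (e : S.charts) (n : ℕ) (γ : SmoothMap S F) : C(IterTan.tanOver e.1.target n, F) where
  toFun w := iterDiff (fun x => γ (e.1.invFun x)) e.1.target n w
  continuous_toFun := continuousOn_iff_continuous_domRestrict.1
    ((γ.2 e.1 e.2).continuousOn_iterDiff n)

variable (S)

/-- The topology of `C^∞(M, F)`: the initial topology for the maps `γ ↦ dⁿγ` (in all charts, for
all `n`) into spaces of continuous maps with the topology of compact convergence. -/
instance : TopologicalSpace (SmoothMap S F) :=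
  ⨅ (e : S.charts) (n : ℕ),
    TopologicalSpace.induced (chartDiff e n) ContinuousMap.compactOpen

/-- The subset `C^∞(M, U)` of `C^∞(M, E)`. -/
def into (U : Set E) : Set (SmoothMap S E) := {γ | ∀ x : M, γ x ∈ U}

open Classical in
/-- A map `M → F`, if smooth, as an element of `C^∞(M, F)` (and the junk value `0` otherwise). -/
def ofFun (h : M → F) : SmoothMap S F := if hs : IsSmooth S h then ⟨h, hs⟩ else 0

/-- `f_♯ : γ ↦ f ∘ (id, γ)`. -/
def sharp (f : M × E → F) (γ : SmoothMap S E) : SmoothMap S F := ofFun S fun x => f (x, γ x)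

/-- `g_* : γ ↦ g ∘ γ`. -/
def pushforward (g : E → F) (γ : SmoothMap S E) : SmoothMap S F := ofFun S fun x => g (γ x)

end SmoothMap

end SmoothMap

end

/-! The proof shows that `sharp S f` has as differential a map of the same kind, namely (γ, η) ↦
(d₂f)_♯(γ, η), and then iterates. Everything is checked in a chart, where the topology of C^∞(M, F)
becomes joint convergence of the n-th differentials along compact sets (`tendsto_iff`).

Continuity: by Faà di Bruno (`IsDiffTower.comp`), the n-th differential of x ↦ f(x, γ x) is dⁿf(w,
Tⁿγ(w)), where Tⁿγ is the iterated tangent map. The passage γ ↦ Tⁿγ respects compact convergence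
(`tendsto_tanIter`), and dⁿf is continuous, so f_♯ is continuous (`continuousOn_sharp`).

Differentiability: Tⁿ(γ + hη) = Tⁿγ + h Tⁿη. Hence the n-th differential of the difference quotient
of f_♯ is a difference quotient of dⁿf at (w, Tⁿγ(w)) in the direction (0, Tⁿη(w)). Its limit
dⁿ⁺¹f((w, Tⁿγ(w)), (0, Tⁿη(w))) must be reached jointly in w, including over boundary points of the
chart, where a differential is only a continuous extension. The mean value theorem, obtained from
Hahn–Banach, gives this (`HasDiffOn.tendsto_slope`). To recognise the limit as the n-th differential
of d₂f ∘ (id, γ, η), one needs dⁿ(df) to be dⁿ⁺¹f up to a permutation of the arguments, that is,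
symmetry of second differentials (`IsDiffTower.shift`).

Openness of C^∞(M, U) is joint continuity of evaluation together with compactness of M. Holomorphy
is read off pointwise from the formula for the first differential. The push-forward is the case of
an f that does not depend on M. -/

set_option linter.unusedSectionVars false

/-! ### Iterated tangent spaces as topological vector spaces -/

namespace IterTan

section Instances

variable (E : Type*) [AddCommGroup E] [TopologicalSpace E]

instance instIsTopologicalAddGroup [IsTopologicalAddGroup E] :
    (n : ℕ) → IsTopologicalAddGroup (IterTan n E)
  | 0 => inferInstanceAs (IsTopologicalAddGroup E)
  | n + 1 =>
    letI := instIsTopologicalAddGroup n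
    inferInstanceAs (IsTopologicalAddGroup (IterTan n E × IterTan n E))

instance instContinuousSMul [Module ℝ E] [ContinuousSMul ℝ E] :
    (n : ℕ) → ContinuousSMul ℝ (IterTan n E)
  | 0 => inferInstanceAs (ContinuousSMul ℝ E)
  | n + 1 =>
    letI := instContinuousSMul n
    inferInstanceAs (ContinuousSMul ℝ (IterTan n E × IterTan n E))

instance instLocallyConvexSpace [Module ℝ E] [LocallyConvexSpace ℝ E] :
    (n : ℕ) → LocallyConvexSpace ℝ (IterTan n E)
  | 0 => inferInstanceAs (LocallyConvexSpace ℝ E)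
  | n + 1 =>
    letI := instLocallyConvexSpace n
    inferInstanceAs (LocallyConvexSpace ℝ (IterTan n E × IterTan n E))

instance instT2Space (E : Type*) [TopologicalSpace E] [T2Space E] : (n : ℕ) → T2Space (IterTan n E)
  | 0 => inferInstanceAs (T2Space E)
  | n + 1 =>
    letI := instT2Space E n
    inferInstanceAs (T2Space (IterTan n E × IterTan n E))

end Instances

end IterTan

section Calculus

theorem subset_closure_interior_prod_univ {E F : Type*} [TopologicalSpace E]
    [TopologicalSpace F] {A : Set E} (hA : A ⊆ closure (interior A)) :
    A ×ˢ (univ : Set F) ⊆ closure (interior (A ×ˢ univ)) := by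
  rw [interior_prod_eq, closure_prod_eq]
  exact prod_mono hA (by simp)

/-! ### The mean value theorem -/

section MeanValue

variable {F : Type*} [AddCommGroup F] [Module ℝ F] [TopologicalSpace F] [IsTopologicalAddGroup F]
  [ContinuousSMul ℝ F] [LocallyConvexSpace ℝ F]

/-- Closed convex neighbourhoods are the targets for which the mean value theorem below bounds
difference quotients by derivatives. -/
theorem exists_convex_closed_nhds_subset {x : F} {W : Set F} (hW : W ∈ 𝓝 x) :
    ∃ K ∈ 𝓝 x, Convex ℝ K ∧ IsClosed K ∧ K ⊆ W := by
  obtain ⟨C, hC, hCc, hCW⟩ := exists_mem_nhds_isClosed_subset hW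
  obtain ⟨V, ⟨hV, hVc⟩, hVC⟩ := (LocallyConvexSpace.convex_basis (𝕜 := ℝ) x).mem_iff.1 hC
  exact ⟨closure V, mem_of_superset hV subset_closure, hVc.closure, isClosed_closure,
    (closure_minimal hVC hCc).trans hCW⟩

/-- The mean value theorem: a difference quotient lies in every closed convex set that contains the
derivatives. -/
theorem slope_mem_of_deriv_mem {c c' : ℝ → F} {K : Set F} (hK : Convex ℝ K) (hKc : IsClosed K)
    {h : ℝ} (hh : h ≠ 0)
    (hc : ∀ t ∈ uIcc 0 h, Tendsto (fun s : ℝ => s⁻¹ • (c (t + s) - c t)) (𝓝[≠] 0) (𝓝 (c' t)))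
    (hm : ∀ t ∈ uIcc 0 h, c' t ∈ K) : h⁻¹ • (c h - c 0) ∈ K := by
  -- A functional separating the slope from `K` reduces the claim to the scalar mean value theorem:
  -- at some intermediate ξ its value on `c' ξ` equals its value on the slope.
  by_contra hn
  obtain ⟨l, u, h1, h2⟩ := geometric_hahn_banach_closed_point hK hKc hn
  have hd : ∀ t ∈ uIcc 0 h, HasDerivAt (fun t => l (c t)) (l (c' t)) t := by
    intro t ht
    rw [hasDerivAt_iff_tendsto_slope_zero]
    refine ((l.continuous.tendsto _).comp (hc t ht)).congr fun s => ?_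
    simp
  obtain ⟨ξ, hξ, he⟩ : ∃ ξ ∈ uIcc 0 h, l (c' ξ) = h⁻¹ * (l (c h) - l (c 0)) := by
    rcases lt_or_gt_of_ne hh with h0 | h0
    · rw [uIcc_of_ge h0.le] at hd ⊢
      obtain ⟨ξ, hξ, he⟩ := exists_hasDerivAt_eq_slope (fun t => l (c t)) (fun t => l (c' t)) h0
        (fun t ht => (hd t ht).continuousAt.continuousWithinAt)
        (fun t ht => hd t (Ioo_subset_Icc_self ht))
      refine ⟨ξ, Ioo_subset_Icc_self hξ, he.trans ?_⟩
      field_simp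
      ring
    · rw [uIcc_of_le h0.le] at hd ⊢
      obtain ⟨ξ, hξ, he⟩ := exists_hasDerivAt_eq_slope (fun t => l (c t)) (fun t => l (c' t)) h0
        (fun t ht => (hd t ht).continuousAt.continuousWithinAt)
        (fun t ht => hd t (Ioo_subset_Icc_self ht))
      refine ⟨ξ, Ioo_subset_Icc_self hξ, he.trans ?_⟩
      field_simp
      ring
  have h3 := h1 _ (hm ξ hξ)
  rw [he] at h3
  simp only [map_smul, map_sub, smul_eq_mul] at h2
  exact lt_asymm h3 h2

theorem abs_lt_of_mem_uIcc_zero {t h δ : ℝ} (ht : t ∈ uIcc 0 h) (hh : |h| < δ) : |t| < δ := by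
  refine lt_of_le_of_lt ?_ hh
  simpa using abs_sub_left_of_mem_uIcc ht

theorem eventually_abs_lt {δ : ℝ} (hδ : 0 < δ) : ∀ᶠ h : ℝ in 𝓝 0, |h| < δ := by
  filter_upwards [Metric.ball_mem_nhds (0 : ℝ) hδ] with h hh
  simpa using hh

/-- The second difference quotient of a function of two real variables converges to the mixed second
derivative. -/
theorem tendsto_second_difference {φ φ₁ φ₁₂ : ℝ → ℝ → F} {a : F}
    (h₁ : ∀ᶠ p : ℝ × ℝ in 𝓝 0, Tendsto (fun s : ℝ => s⁻¹ • (φ (p.1 + s) p.2 - φ p.1 p.2))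
      (𝓝[≠] 0) (𝓝 (φ₁ p.1 p.2)))
    (h₁₂ : ∀ᶠ p : ℝ × ℝ in 𝓝 0, Tendsto (fun s : ℝ => s⁻¹ • (φ₁ p.1 (p.2 + s) - φ₁ p.1 p.2))
      (𝓝[≠] 0) (𝓝 (φ₁₂ p.1 p.2)))
    (hc : Tendsto (fun p : ℝ × ℝ => φ₁₂ p.1 p.2) (𝓝 0) (𝓝 a)) :
    Tendsto (fun h : ℝ => h⁻¹ • h⁻¹ • (φ h h - φ h 0 - (φ 0 h - φ 0 0))) (𝓝[≠] 0) (𝓝 a) := by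
  intro W hW
  obtain ⟨K, hK, hKc, hKcl, hKW⟩ := exists_convex_closed_nhds_subset hW
  obtain ⟨δ, hδ, H⟩ := Metric.eventually_nhds_iff.1 (h₁.and (h₁₂.and (hc.eventually_mem hK)))
  have H' : ∀ s t : ℝ, |s| < δ → |t| < δ → _ := fun s t hs ht => H (y := (s, t)) (by
    simpa [Prod.dist_eq] using ⟨hs, ht⟩)
  have hev : ∀ᶠ h : ℝ in 𝓝[≠] 0, |h| < δ := nhdsWithin_le_nhds (eventually_abs_lt hδ)
  refine mem_map.2 ?_
  filter_upwards [hev, self_mem_nhdsWithin] with h hhδ hh0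
  apply hKW
  have hh0 : h ≠ 0 := hh0
  -- The second difference is a slope in `s` of a slope in the second variable. Its `s`-derivative
  -- is again a slope, of `φ₁`, so the mean value theorem is used twice with the same `K`.
  have key := slope_mem_of_deriv_mem (c := fun s => h⁻¹ • (φ s h - φ s 0))
    (c' := fun s => h⁻¹ • (φ₁ s h - φ₁ s 0)) hKc hKcl hh0 ?_ ?_
  · simpa only [← smul_sub] using key
  · intro t ht
    have ht' := abs_lt_of_mem_uIcc_zero ht hhδ
    refine (((H' t h ht' hhδ).1.sub (H' t 0 ht' (by simpa using hδ)).1).const_smul h⁻¹).congr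
      fun s => ?_
    simp only [← smul_sub, smul_comm h⁻¹ s⁻¹]
    congr 2
    abel
  · intro t ht
    have ht' := abs_lt_of_mem_uIcc_zero ht hhδ
    exact slope_mem_of_deriv_mem (c := fun r => φ₁ t r) (c' := fun r => φ₁₂ t r) hKc hKcl hh0
      (fun r hr => (H' t r ht' (abs_lt_of_mem_uIcc_zero hr hhδ)).2.1)
      (fun r hr => (H' t r ht' (abs_lt_of_mem_uIcc_zero hr hhδ)).2.2)

end MeanValue

/-! ### Elementary rules -/

variable {E F G : Type*} [AddCommGroup E] [Module ℝ E] [TopologicalSpace E]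
  [AddCommGroup F] [Module ℝ F] [TopologicalSpace F]
  [AddCommGroup G] [Module ℝ G] [TopologicalSpace G]

theorem HasDiffOn.prodMk {f : E → F} {g : E → G} {f' : E × E → F} {g' : E × E → G} {U : Set E}
    (hf : HasDiffOn f f' U) (hg : HasDiffOn g g' U) :
    HasDiffOn (fun x => (f x, g x)) (fun p => (f' p, g' p)) U where
  continuousOn := hf.continuousOn.prodMk hg.continuousOn
  tendsto x hx v := (hf.tendsto x hx v).prodMk_nhds (hg.tendsto x hx v)
  continuousOn_diff := hf.continuousOn_diff.prodMk hg.continuousOn_diff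

/-- A linear substitution turns difference quotients into difference quotients exactly, so no mean
value argument is needed. Asking for the unbundled identity `hl` makes the rule applicable to
componentwise maps on iterated tangent spaces and to `collect`. -/
theorem HasDiffOn.comp_linear {f : F → G} {f' : F × F → G} {V : Set F} (hf : HasDiffOn f f' V)
    {L : E → F} (hL : Continuous L) (hl : ∀ x v (t : ℝ), L (x + t • v) = L x + t • L v)
    {A : Set E} (hA : MapsTo L A V) (hAi : MapsTo L (interior A) (interior V)) :
    HasDiffOn (fun x => f (L x)) (fun p => f' (L p.1, L p.2)) A where
  continuousOn := hf.continuousOn.comp hL.continuousOn hA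
  tendsto x hx v := by
    refine (hf.tendsto (L x) (hAi hx) (L v)).congr fun h => ?_
    rw [hl]
  continuousOn_diff := hf.continuousOn_diff.comp (by fun_prop) fun p hp => ⟨hA hp.1, mem_univ _⟩

theorem HasDiffOn.slope_mem_of_mem_interior [IsTopologicalAddGroup F] [ContinuousSMul ℝ F]
    [LocallyConvexSpace ℝ F] {f : E → F} {f' : E × E → F} {A : Set E}
    (hf : HasDiffOn f f' A) {K : Set F} (hK : Convex ℝ K) (hKc : IsClosed K) {h : ℝ} (hh : h ≠ 0)
    {y u : E} (hy : ∀ t ∈ uIcc 0 h, y + t • u ∈ interior A)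
    (hm : ∀ t ∈ uIcc 0 h, f' (y + t • u, u) ∈ K) : h⁻¹ • (f (y + h • u) - f y) ∈ K := by
  have := slope_mem_of_deriv_mem (c := fun t => f (y + t • u)) hK hKc hh (fun t ht => ?_) hm
  · simpa using this
  · refine (hf.tendsto _ (hy t ht) u).congr fun s => ?_
    rw [add_smul, add_assoc]

variable [IsTopologicalAddGroup E] [ContinuousSMul ℝ E]

theorem tendsto_add_smul_nhds (x v : E) : Tendsto (fun h : ℝ => x + h • v) (𝓝[≠] 0) (𝓝 x) := by
  have : Tendsto (fun h : ℝ => x + h • v) (𝓝 0) (𝓝 (x + (0 : ℝ) • v)) :=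
    Continuous.tendsto (by fun_prop) 0
  simpa using this.mono_left nhdsWithin_le_nhds

theorem HasDiffOn.congr {f g : E → F} {f' g' : E × E → F} {U : Set E} (hf : HasDiffOn f f' U)
    (h : EqOn g f U) (h' : EqOn g' f' (U ×ˢ univ)) : HasDiffOn g g' U where
  continuousOn := hf.continuousOn.congr h
  tendsto x hx v := by
    rw [h' ⟨interior_subset hx, mem_univ _⟩]
    refine (hf.tendsto x hx v).congr' ?_
    filter_upwards [(tendsto_add_smul_nhds x v).eventually_mem (mem_interior_iff_mem_nhds.1 hx)]
      with t ht
    rw [h ht, h (interior_subset hx)]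
  continuousOn_diff := hf.continuousOn_diff.congr h'

/-- At interior points both are limits of the same quotients; density of the interior and continuity
give the rest. -/
theorem HasDiffOn.eqOn_diff [T2Space F] {f g : E → F} {f' g' : E × E → F} {U : Set E}
    (hU : U ⊆ closure (interior U)) (hf : HasDiffOn f f' U) (hg : HasDiffOn g g' U)
    (h : EqOn f g U) : EqOn f' g' (U ×ˢ univ) := by
  refine EqOn.of_subset_closure (s := interior U ×ˢ univ) ?_ hf.continuousOn_diff
    hg.continuousOn_diff (prod_mono interior_subset Subset.rfl) ?_
  · rintro ⟨x, v⟩ ⟨hx, -⟩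
    refine tendsto_nhds_unique (hf.tendsto x hx v) ((hg.tendsto x hx v).congr' ?_)
    filter_upwards [(tendsto_add_smul_nhds x v).eventually_mem (mem_interior_iff_mem_nhds.1 hx)]
      with t ht
    rw [h ht, h (interior_subset hx)]
  · rw [closure_prod_eq]
    exact prod_mono hU (by simp)

/-! ### Difference quotients with varying base point and direction -/

section Slope

variable [IsTopologicalAddGroup F] [ContinuousSMul ℝ F] [LocallyConvexSpace ℝ F]

/-- Difference quotients converge jointly in the base point and the direction, also at boundary
points of the domain, as long as the segments stay in the domain. -/
theorem HasDiffOn.tendsto_slope {f : E → F} {f' : E × E → F} {A : Set E} (hf : HasDiffOn f f' A)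
    (hA : A ⊆ closure (interior A)) {y₀ u₀ : E} (hy₀ : y₀ ∈ A) {Z : Set E}
    (hadm : ∀ᶠ p : ℝ × E × E in 𝓝 0 ×ˢ (𝓝[A] y₀ ×ˢ 𝓝[Z] u₀), p.2.1 + p.1 • p.2.2 ∈ A) :
    Tendsto (fun p : ℝ × E × E => p.1⁻¹ • (f (p.2.1 + p.1 • p.2.2) - f p.2.1))
      (𝓝[≠] 0 ×ˢ (𝓝[A] y₀ ×ˢ 𝓝[Z] u₀)) (𝓝 (f' (y₀, u₀))) := by
  intro W hW
  obtain ⟨K, hK, hKc, hKcl, hKW⟩ := exists_convex_closed_nhds_subset hW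
  have hlim : Tendsto (fun p : ℝ × E × E => (p.2.1 + p.1 • p.2.2, p.2.2))
      (𝓝 0 ×ˢ (𝓝[A] y₀ ×ˢ 𝓝[Z] u₀)) (𝓝[A ×ˢ univ] (y₀, u₀)) := by
    refine tendsto_nhdsWithin_iff.2 ⟨?_, hadm.mono fun p hp => ⟨hp, mem_univ _⟩⟩
    have : Tendsto (fun p : ℝ × E × E => (p.2.1 + p.1 • p.2.2, p.2.2))
        (𝓝 (0, y₀, u₀)) (𝓝 (y₀ + (0 : ℝ) • u₀, u₀)) :=
      Continuous.tendsto (by fun_prop) (0, y₀, u₀)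
    rw [zero_smul, add_zero, nhds_prod_eq (x := (0 : ℝ)), nhds_prod_eq (x := y₀)] at this
    rw [nhds_prod_eq (x := y₀)]
    exact this.mono_left (Filter.prod_mono le_rfl (Filter.prod_mono nhdsWithin_le_nhds nhdsWithin_le_nhds))
  have hcont := (hf.continuousOn_diff (y₀, u₀) ⟨hy₀, mem_univ _⟩).tendsto.comp hlim
  obtain ⟨pa, hpa, pbc, hpbc, H⟩ := eventually_prod_iff.1 (hadm.and (hcont.eventually_mem hK))
  obtain ⟨pb, hpb, pc, hpc, H'⟩ := eventually_prod_iff.1 hpbc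
  obtain ⟨δ, hδ, hpa⟩ := Metric.eventually_nhds_iff.1 hpa
  obtain ⟨N, hN, hy₀N, hNA⟩ := mem_nhdsWithin.1 hpb
  have hS : ∀ t : ℝ, |t| < δ → ∀ y ∈ N ∩ A, ∀ u, pc u → y + t • u ∈ A ∧ f' (y + t • u, u) ∈ K :=
    fun t ht y hy u hu => H (hpa (by simpa [Real.dist_eq] using ht)) (H' (hNA hy) hu)
  -- Translating the open set `N ∩ interior A` by `t • u` gives an open subset of `A`. Segments
  -- starting at interior points therefore stay in the interior, where the derivative is a genuine
  -- limit.
  have hint : ∀ t : ℝ, |t| < δ → ∀ y ∈ N ∩ interior A, ∀ u, pc u → y + t • u ∈ interior A := by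
    intro t ht y hy u hu
    have ho : IsOpen ((fun z => z + t • u) '' (N ∩ interior A)) :=
      (Homeomorph.addRight (t • u)).isOpenMap _ (hN.inter isOpen_interior)
    refine interior_maximal ?_ ho ⟨y, hy, rfl⟩
    rintro _ ⟨z, hz, rfl⟩
    exact (hS t ht z ⟨hz.1, interior_subset hz.2⟩ u hu).1
  have hev : ∀ᶠ h : ℝ in 𝓝[≠] 0, |h| < δ ∧ h ≠ 0 := by
    refine Eventually.and (nhdsWithin_le_nhds ?_) self_mem_nhdsWithin
    exact eventually_abs_lt hδ
  have hbase : ∀ᶠ y in 𝓝[A] y₀, y ∈ N ∩ A :=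
    inter_mem (mem_nhdsWithin_of_mem_nhds (hN.mem_nhds hy₀N)) self_mem_nhdsWithin
  refine mem_map.2 ?_
  filter_upwards [hev.prod_mk (hbase.prod_mk hpc)]
  rintro ⟨h, y, u⟩ ⟨⟨hhδ, hh0⟩, hy, hu⟩
  apply hKW
  -- A boundary base point is a limit of interior ones. For fixed `h` and `u` the slope is
  -- continuous in the base point, and `K` is closed, so the bound survives.
  have hyc : y ∈ closure (N ∩ interior A) := hN.inter_closure ⟨hy.1, hA hy.2⟩
  have : (𝓝[N ∩ interior A] y).NeBot := mem_closure_iff_nhdsWithin_neBot.1 hyc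
  have hsub : N ∩ interior A ⊆ A := inter_subset_right.trans interior_subset
  have hyu : ContinuousWithinAt (fun z => f (z + h • u)) (N ∩ interior A) y := by
    refine ContinuousWithinAt.comp (t := A)
      (hf.continuousOn _ (hS h hhδ y hy u hu).1) (by fun_prop) fun z hz => ?_
    exact (hS h hhδ z ⟨hz.1, interior_subset hz.2⟩ u hu).1
  have hlim : Tendsto (fun z => h⁻¹ • (f (z + h • u) - f z)) (𝓝[N ∩ interior A] y)
      (𝓝 (h⁻¹ • (f (y + h • u) - f y))) :=
    (hyu.tendsto.sub ((hf.continuousOn y hy.2).mono hsub).tendsto).const_smul _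
  refine hKcl.mem_of_tendsto hlim (eventually_nhdsWithin_of_forall fun z hz => ?_)
  exact hf.slope_mem_of_mem_interior hKc hKcl hh0
    (fun t ht => hint t (abs_lt_of_mem_uIcc_zero ht hhδ) z hz u hu)
    (fun t ht => (hS t (abs_lt_of_mem_uIcc_zero ht hhδ) z ⟨hz.1, interior_subset hz.2⟩ u hu).2)

/-- The variant with fixed base point and moving direction is what the chain rule needs. -/
theorem HasDiffOn.tendsto_slope_of_mem_interior {f : E → F} {f' : E × E → F} {A : Set E}
    (hf : HasDiffOn f f' A) (hA : A ⊆ closure (interior A)) {y₀ : E} (hy₀ : y₀ ∈ interior A)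
    (u₀ : E) : Tendsto (fun p : ℝ × E => p.1⁻¹ • (f (y₀ + p.1 • p.2) - f y₀))
      (𝓝[≠] 0 ×ˢ 𝓝 u₀) (𝓝 (f' (y₀, u₀))) := by
  have hadm : ∀ᶠ p : ℝ × E × E in 𝓝 0 ×ˢ (𝓝[A] y₀ ×ˢ 𝓝[univ] u₀), p.2.1 + p.1 • p.2.2 ∈ A := by
    have : Tendsto (fun p : ℝ × E × E => p.2.1 + p.1 • p.2.2)
        (𝓝 (0, y₀, u₀)) (𝓝 (y₀ + (0 : ℝ) • u₀)) := Continuous.tendsto (by fun_prop) (0, y₀, u₀)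
    rw [zero_smul, add_zero, nhds_prod_eq, nhds_prod_eq] at this
    exact (this.mono_left (Filter.prod_mono le_rfl (Filter.prod_mono nhdsWithin_le_nhds nhdsWithin_le_nhds)))
      (mem_interior_iff_mem_nhds.1 hy₀)
  have h := hf.tendsto_slope hA (interior_subset hy₀) hadm
  rw [nhdsWithin_univ] at h
  refine h.comp (g := fun p : ℝ × E × E => p.1⁻¹ • (f (p.2.1 + p.1 • p.2.2) - f p.2.1))
    (f := fun p : ℝ × E => (p.1, y₀, p.2)) ?_
  refine tendsto_fst.prodMk (Tendsto.prodMk ?_ tendsto_snd)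
  exact tendsto_const_pure.mono_right (pure_le_nhdsWithin (interior_subset hy₀))

/-- The chain rule. -/
theorem HasDiffOn.comp {f : E → F} {f' : E × E → F} {V : Set E} {g : G → E} {g' : G × G → E}
    {A : Set G} (hf : HasDiffOn f f' V) (hg : HasDiffOn g g' A) (hV : V ⊆ closure (interior V))
    (hm : MapsTo g A V) (hmi : MapsTo g (interior A) (interior V)) :
    HasDiffOn (fun x => f (g x)) (fun p => f' (g p.1, g' p)) A where
  continuousOn := hf.continuousOn.comp hg.continuousOn hm
  tendsto x hx v := by
    -- For h ≠ 0, g(x + hv) = g(x) + h·u with u the difference quotient of g, which tends to `g' (x,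
    -- v)`.
    have h := (hf.tendsto_slope_of_mem_interior hV (hmi hx) (g' (x, v))).comp
      (tendsto_id.prodMk (hg.tendsto x hx v))
    refine h.congr' ?_
    filter_upwards [self_mem_nhdsWithin] with h hh
    simp only [Function.comp_apply, id, smul_smul]
    rw [mul_inv_cancel₀ hh]
    simp
  continuousOn_diff := by
    refine hf.continuousOn_diff.comp (ContinuousOn.prodMk ?_ hg.continuousOn_diff) ?_
    · exact hg.continuousOn.comp continuousOn_fst fun p hp => hp.1
    · exact fun p hp => ⟨hm hp.1, mem_univ _⟩

/-! ### Symmetry of second differentials -/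

/-- Apply the two-variable lemma to the surface (s, t) ↦ a + s b + t c + st d. Its `s`-velocity is b
+ t d, and the term st d is there to make the last component `d` of the argument of `g''` appear
when this velocity is differentiated in `t`. -/
theorem HasDiffOn.tendsto_second_difference {g : E → F} {g' : E × E → F}
    {g'' : (E × E) × (E × E) → F} {A : Set E} (h₁ : HasDiffOn g g' A)
    (h₂ : HasDiffOn g' g'' (A ×ˢ univ)) {a : E} (ha : a ∈ interior A) (b c d : E) :
    Tendsto (fun h : ℝ => h⁻¹ • h⁻¹ • (g (a + h • b + h • c + (h * h) • d) - g (a + h • b) -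
      (g (a + h • c) - g a))) (𝓝[≠] 0) (𝓝 (g'' ((a, b), (c, d)))) := by
  have hp : Continuous fun p : ℝ × ℝ => a + p.1 • b + p.2 • c + (p.1 * p.2) • d := by fun_prop
  have hmem : ∀ᶠ p : ℝ × ℝ in 𝓝 0, a + p.1 • b + p.2 • c + (p.1 * p.2) • d ∈ interior A :=
    hp.continuousAt.eventually_mem (by simpa using isOpen_interior.mem_nhds ha)
  have := _root_.tendsto_second_difference (a := g'' ((a, b), (c, d)))
    (φ := fun s t => g (a + s • b + t • c + (s * t) • d))
    (φ₁ := fun s t => g' (a + s • b + t • c + (s * t) • d, b + t • d))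
    (φ₁₂ := fun s t => g'' ((a + s • b + t • c + (s * t) • d, b + t • d), (c + s • d, d))) ?_ ?_ ?_
  · simpa using this
  · filter_upwards [hmem] with p hp
    refine (h₁.tendsto _ hp _).congr fun s => ?_
    congr 3
    module
  · filter_upwards [hmem] with p hp
    refine (h₂.tendsto (_, _) (by simpa [interior_prod_eq] using hp) (_, _)).congr fun s => ?_
    congr 3
    simp only [Prod.smul_mk, Prod.mk_add_mk, Prod.mk.injEq]
    constructor <;> module
  · have hc : ContinuousAt g'' ((a, b), (c, d)) :=
      h₂.continuousOn_diff.continuousAt (mem_of_superset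
        ((isOpen_interior.prod isOpen_univ).prod isOpen_univ |>.mem_nhds
          (show ((a, b), (c, d)) ∈ (interior A ×ˢ univ) ×ˢ univ from ⟨⟨ha, mem_univ _⟩, mem_univ _⟩))
        (prod_mono (prod_mono interior_subset Subset.rfl) Subset.rfl))
    have hq : Continuous fun p : ℝ × ℝ =>
        ((a + p.1 • b + p.2 • c + (p.1 * p.2) • d, b + p.2 • d), (c + p.1 • d, d)) := by fun_prop
    refine ContinuousAt.tendsto (f := fun p : ℝ × ℝ => g'' _) ?_ |>.trans_eq ?_
    · refine ContinuousAt.comp (g := g'') ?_ hq.continuousAt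
      simpa using hc
    · simp

/-- The second difference quotient is symmetric in `b` and `c`, so its limit is too at interior
points, and then everywhere by density. -/
theorem HasDiffOn.diff_diff_comm [T2Space F] {g : E → F} {g' : E × E → F}
    {g'' : (E × E) × (E × E) → F} {A : Set E} (hA : A ⊆ closure (interior A))
    (h₁ : HasDiffOn g g' A) (h₂ : HasDiffOn g' g'' (A ×ˢ univ)) {a : E} (ha : a ∈ A) (b c d : E) :
    g'' ((a, b), (c, d)) = g'' ((a, c), (b, d)) := by
  have H : EqOn g'' (fun p => g'' ((p.1.1, p.2.1), (p.1.2, p.2.2))) ((A ×ˢ univ) ×ˢ univ) := by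
    refine EqOn.of_subset_closure (s := (interior A ×ˢ univ) ×ˢ univ) ?_ h₂.continuousOn_diff
      (h₂.continuousOn_diff.comp (by fun_prop) fun p hp => ⟨⟨hp.1.1, mem_univ _⟩, mem_univ _⟩)
      (prod_mono (prod_mono interior_subset Subset.rfl) Subset.rfl) ?_
    · rintro ⟨⟨a, b⟩, ⟨c, d⟩⟩ ⟨⟨ha, -⟩, -⟩
      refine tendsto_nhds_unique (h₁.tendsto_second_difference h₂ ha b c d)
        ((h₁.tendsto_second_difference h₂ ha c b d).congr fun h => ?_)
      rw [add_right_comm a (h • c), sub_sub_sub_comm]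
    · rw [closure_prod_eq, closure_prod_eq]
      exact prod_mono (prod_mono hA (by simp)) (by simp)
  exact H (x := ((a, b), (c, d))) ⟨⟨ha, mem_univ _⟩, mem_univ _⟩

end Slope

end Calculus

/-! ### Componentwise operations on iterated tangent spaces -/

namespace IterTan

section

variable {E F G : Type*}

theorem zip_map_fst_map_snd : (n : ℕ) → (w : IterTan n (E × F)) →
    zip n (map Prod.fst n w) (map Prod.snd n w) = w
  | 0, _ => rfl
  | n + 1, w => Prod.ext (zip_map_fst_map_snd n w.1) (zip_map_fst_map_snd n w.2)

theorem map_snd_zip : (n : ℕ) → (a : IterTan n E) → (b : IterTan n F) →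
    map Prod.snd n (zip n a b) = b
  | 0, _, _ => rfl
  | n + 1, a, b => Prod.ext (map_snd_zip n a.1 b.1) (map_snd_zip n a.2 b.2)

theorem map_mem_tanOver {φ : E → F} {A : Set E} {B : Set F} (h : MapsTo φ A B) :
    (n : ℕ) → MapsTo (map φ n) (tanOver A n) (tanOver B n)
  | 0, _, hw => h hw
  | n + 1, _, hw => ⟨map_mem_tanOver h n hw.1, mem_univ _⟩

theorem zip_mem_tanOver {A : Set E} {B : Set F} : (n : ℕ) → {a : IterTan n E} →
    {b : IterTan n F} → a ∈ tanOver A n → b ∈ tanOver B n → zip n a b ∈ tanOver (A ×ˢ B) n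
  | 0, _, _, ha, hb => ⟨ha, hb⟩
  | n + 1, _, _, ha, hb => ⟨zip_mem_tanOver n ha.1 hb.1, mem_univ _⟩

theorem zeroAt_mem_tanOver [AddCommGroup E] {A : Set E} {x : E} (hx : x ∈ A) :
    (n : ℕ) → zeroAt x n ∈ tanOver A n
  | 0 => hx
  | n + 1 => ⟨zeroAt_mem_tanOver hx n, mem_univ _⟩

theorem interior_tanOver [TopologicalSpace E] (A : Set E) :
    (n : ℕ) → interior (tanOver A n) = tanOver (interior A) n
  | 0 => rfl
  | n + 1 => by
    refine (interior_prod_eq _ _).trans ?_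
    rw [interior_tanOver A n, interior_univ]
    rfl

theorem isOpen_tanOver [TopologicalSpace E] {A : Set E} (hA : IsOpen A) (n : ℕ) :
    IsOpen (tanOver A n) := by
  rw [← interior_eq_iff_isOpen, interior_tanOver, hA.interior_eq]

theorem tanOver_subset_closure_interior [TopologicalSpace E] {A : Set E}
    (hA : A ⊆ closure (interior A)) : (n : ℕ) → tanOver A n ⊆ closure (interior (tanOver A n))
  | 0 => hA
  | n + 1 => subset_closure_interior_prod_univ (tanOver_subset_closure_interior hA n)

end

section Topology

variable {E F : Type*} [TopologicalSpace E] [TopologicalSpace F]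

theorem continuous_map {φ : E → F} (h : Continuous φ) : (n : ℕ) → Continuous (map φ n)
  | 0 => h
  | n + 1 =>
    ((continuous_map h n).comp continuous_fst).prodMk ((continuous_map h n).comp continuous_snd)

theorem continuous_zip : (n : ℕ) →
    Continuous fun p : IterTan n E × IterTan n F => zip n p.1 p.2
  | 0 => continuous_id
  | n + 1 =>
    ((continuous_zip n).comp ((continuous_fst.comp continuous_fst).prodMk
      (continuous_fst.comp continuous_snd))).prodMk
    ((continuous_zip n).comp ((continuous_snd.comp continuous_fst).prodMk
      (continuous_snd.comp continuous_snd)))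

end Topology

section Linear

variable {E F : Type*} [AddCommGroup E] [Module ℝ E] [AddCommGroup F] [Module ℝ F]

theorem zip_add_smul : (n : ℕ) → (a a' : IterTan n E) → (b b' : IterTan n F) → (t : ℝ) →
    zip n (a + t • a') (b + t • b') = zip n a b + t • zip n a' b'
  | 0, _, _, _, _, _ => rfl
  | n + 1, a, a', b, b', t =>
    Prod.ext (zip_add_smul n a.1 a'.1 b.1 b'.1 t) (zip_add_smul n a.2 a'.2 b.2 b'.2 t)

theorem map_add_smul {φ : E → F} (h : ∀ x v (t : ℝ), φ (x + t • v) = φ x + t • φ v) :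
    (n : ℕ) → (w w' : IterTan n E) → (t : ℝ) → map φ n (w + t • w') = map φ n w + t • map φ n w'
  | 0, w, w', t => h w w' t
  | n + 1, w, w', t => Prod.ext (map_add_smul h n w.1 w'.1 t) (map_add_smul h n w.2 w'.2 t)

end Linear

end IterTan

open IterTan

/-! ### Towers of higher differentials -/

section Tower

variable {E F G : Type*} [AddCommGroup E] [Module ℝ E] [TopologicalSpace E]
  [AddCommGroup F] [Module ℝ F] [TopologicalSpace F]
  [AddCommGroup G] [Module ℝ G] [TopologicalSpace G]

theorem IsDiffTower.smoothOn {f : E → F} {U : Set E} {g : (n : ℕ) → IterTan n E → F}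
    (h : IsDiffTower f U g) : SmoothOn f U := ⟨g, h⟩

theorem IsDiffTower.continuousOn {f : E → F} {U : Set E} {g : (n : ℕ) → IterTan n E → F}
    (h : IsDiffTower f U g) (n : ℕ) : ContinuousOn (g n) (tanOver U n) := (h.succ n).continuousOn

theorem IsDiffTower.add_smul [IsTopologicalAddGroup F] [ContinuousSMul ℝ F] {f₁ f₂ : E → F}
    {U : Set E} {g₁ g₂ : (n : ℕ) → IterTan n E → F} (h₁ : IsDiffTower f₁ U g₁)
    (h₂ : IsDiffTower f₂ U g₂) (t : ℝ) :
    IsDiffTower (fun x => f₁ x + t • f₂ x) U (fun n w => g₁ n w + t • g₂ n w) where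
  zero := by rw [h₁.zero, h₂.zero]; rfl
  succ n := (h₁.succ n).add ((h₂.succ n).const_smul t)

theorem isDiffTower_zero (U : Set E) : IsDiffTower (0 : E → F) U (fun _ => 0) :=
  ⟨rfl, fun _ => HasDiffOn.zero _⟩

theorem IsDiffTower.prodMk {f : E → F} {g : E → G} {U : Set E} {a : (n : ℕ) → IterTan n E → F}
    {b : (n : ℕ) → IterTan n E → G} (ha : IsDiffTower f U a) (hb : IsDiffTower g U b) :
    IsDiffTower (fun x => (f x, g x)) U (fun n w => (a n w, b n w)) where
  zero := by rw [ha.zero, hb.zero]; rfl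
  succ n := (ha.succ n).prodMk (hb.succ n)

theorem IsDiffTower.comp_clm {f : F → G} {V : Set F} {g : (n : ℕ) → IterTan n F → G}
    (h : IsDiffTower f V g) (L : E →L[ℝ] F) {A : Set E} (hA : MapsTo L A V)
    (hAi : MapsTo L (interior A) (interior V)) :
    IsDiffTower (fun x => f (L x)) A (fun n w => g n (map L n w)) where
  zero := by rw [h.zero]; rfl
  succ n := (h.succ n).comp_linear (continuous_map L.continuous n)
    (map_add_smul (fun x v t => by simp) n) (map_mem_tanOver hA n) (by
      rw [interior_tanOver, interior_tanOver]; exact map_mem_tanOver hAi n)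

theorem SmoothOn.comp_clm {f : F → G} {V : Set F} (h : SmoothOn f V) (L : E →L[ℝ] F) {A : Set E}
    (hA : MapsTo L A V) (hAi : MapsTo L (interior A) (interior V)) :
    SmoothOn (fun x => f (L x)) A :=
  (h.isDiffTower.comp_clm L hA hAi).smoothOn

/-- The higher differentials of the identity. -/
def idTower (E : Type*) : (n : ℕ) → IterTan n E → E
  | 0, w => w
  | n + 1, w => idTower E n w.2

theorem idTower_add_smul : (n : ℕ) → (w w' : IterTan n E) → (t : ℝ) →
    idTower E n (w + t • w') = idTower E n w + t • idTower E n w'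
  | 0, _, _, _ => rfl
  | n + 1, w, w', t => idTower_add_smul n w.2 w'.2 t

theorem continuous_idTower : (n : ℕ) → Continuous (idTower E n)
  | 0 => continuous_id
  | n + 1 => (continuous_idTower n).comp continuous_snd

theorem isDiffTower_id (U : Set E) : IsDiffTower (fun x => x) U (idTower E) where
  zero := rfl
  succ n :=
    { continuousOn := (continuous_idTower n).continuousOn
      tendsto := fun x _ v => by
        refine tendsto_const_nhds.congr' ?_
        filter_upwards [self_mem_nhdsWithin] with h hh
        have hh : h ≠ 0 := hh
        rw [idTower_add_smul, add_sub_cancel_left, smul_smul, inv_mul_cancel₀ hh, one_smul]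
        rfl
      continuousOn_diff := (continuous_idTower (n + 1)).continuousOn }

theorem idTower_prod : (n : ℕ) → (w : IterTan n (E × F)) →
    (idTower E n (map Prod.fst n w), idTower F n (map Prod.snd n w)) = idTower (E × F) n w
  | 0, _ => rfl
  | n + 1, w => idTower_prod n w.2

section

variable [IsTopologicalAddGroup E] [ContinuousSMul ℝ E]

theorem IsDiffTower.congr {f g : E → F} {U : Set E} {d : (n : ℕ) → IterTan n E → F}
    (h : IsDiffTower f U d) (hfg : EqOn g f U) :
    SmoothOn g U := by
  -- Entry 0 of a tower must equal the map everywhere, not merely on `U`, so it is replaced; the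
  -- higher entries can stay.
  refine ⟨fun n => match n with | 0 => g | n + 1 => d (n + 1), rfl, fun n => ?_⟩
  cases n with
  | zero => exact (h.succ 0).congr (by rw [h.zero]; exact hfg) fun _ _ => rfl
  | succ n => exact h.succ (n + 1)

theorem SmoothOn.congr {f g : E → F} {U : Set E} (h : SmoothOn f U) (hfg : EqOn g f U) :
    SmoothOn g U :=
  h.isDiffTower.congr hfg

theorem IsDiffTower.eqOn [T2Space F] {f g : E → F} {U : Set E} {a b : (n : ℕ) → IterTan n E → F}
    (hU : U ⊆ closure (interior U)) (ha : IsDiffTower f U a) (hb : IsDiffTower g U b)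
    (h : EqOn f g U) : (n : ℕ) → EqOn (a n) (b n) (tanOver U n)
  | 0 => by rw [ha.zero, hb.zero]; exact h
  | n + 1 => (ha.succ n).eqOn_diff (tanOver_subset_closure_interior hU n) (hb.succ n)
      (IsDiffTower.eqOn hU ha hb h n)

theorem IsDiffTower.iterDiff_eqOn [T2Space F] {f : E → F} {U : Set E}
    {a : (n : ℕ) → IterTan n E → F} (hU : U ⊆ closure (interior U)) (ha : IsDiffTower f U a)
    (n : ℕ) : EqOn (iterDiff f U n) (a n) (tanOver U n) :=
  ha.smoothOn.isDiffTower.eqOn hU ha (fun _ _ => rfl) n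

variable [IsTopologicalAddGroup F] [ContinuousSMul ℝ F] [LocallyConvexSpace ℝ F]

/-- Towers differentiate on the outside, dⁿ⁺¹f = d(dⁿf), whereas here dⁿ(df) is wanted. Regrouping
the arguments into first and second components identifies it with dⁿ⁺¹f; each inductive step
exchanges the two middle arguments of a second differential, which is allowed by symmetry. -/
theorem IsDiffTower.shift [T2Space F] {f : E → F} {U : Set E} {d : (n : ℕ) → IterTan n E → F}
    (hU : U ⊆ closure (interior U)) (h : IsDiffTower f U d) :
    IsDiffTower (E := E × E) (d 1) (U ×ˢ univ)
      (fun n (w : IterTan n (E × E)) => d (n + 1) (map Prod.fst n w, map Prod.snd n w)) where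
  zero := rfl
  succ n := by
    have hm : MapsTo (Prod.fst : E × E → E) (U ×ˢ univ) U := fun p hp => hp.1
    have hmi : MapsTo (Prod.fst : E × E → E) (interior (U ×ˢ univ)) (interior U) := by
      rw [interior_prod_eq]; exact fun p hp => hp.1
    have := (h.succ (n + 1)).comp_linear
      (L := fun w : IterTan n (E × E) => (map Prod.fst n w, map Prod.snd n w))
      (A := tanOver (U ×ˢ univ) n)
      ((continuous_map continuous_fst n).prodMk (continuous_map continuous_snd n))
      (fun x v t => Prod.ext (map_add_smul (fun _ _ _ => rfl) n x v t)
        (map_add_smul (fun _ _ _ => rfl) n x v t))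
      (fun w hw => ⟨map_mem_tanOver hm n hw, mem_univ _⟩)
      (by
        rw [interior_tanOver, interior_tanOver]
        exact fun w hw => ⟨map_mem_tanOver hmi n hw, mem_univ _⟩)
    refine this.congr (fun _ _ => rfl) fun w hw => ?_
    exact (HasDiffOn.diff_diff_comm (tanOver_subset_closure_interior hU n) (h.succ n)
      (h.succ (n + 1)) (map_mem_tanOver hm n hw.1) _ _ _).symm

end

end Tower

/-! ### Iterated tangent maps -/

section Tangent

/-- The higher differentials of the tangent map `(x, v) ↦ (f x, df (x, v))` in terms of those
of `f`. -/
def tanSeq {E F : Type*} (h : (k : ℕ) → IterTan k E → F) (k : ℕ) (w : IterTan k (E × E)) : F × F :=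
  (h k (map Prod.fst k w), h (k + 1) (map Prod.fst k w, map Prod.snd k w))

/-- The higher differentials of the `n`-th tangent map in terms of those of `f`. -/
def tanIter {E F : Type*} : (n : ℕ) → ((k : ℕ) → IterTan k E → F) →
    (k : ℕ) → IterTan k (IterTan n E) → IterTan n F
  | 0, h => h
  | n + 1, h => tanSeq (tanIter n h)

/-- The `n`-th tangent map of a map with higher differentials `h`. -/
def tanMap {E F : Type*} (n : ℕ) (h : (k : ℕ) → IterTan k E → F) (w : IterTan n E) : IterTan n F :=
  tanIter n h 0 w

theorem tanMap_mem_tanOver {E F : Type*} {h : (k : ℕ) → IterTan k E → F} {A : Set E} {B : Set F}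
    (hm : MapsTo (h 0) A B) : (n : ℕ) → MapsTo (tanMap n h) (tanOver A n) (tanOver B n)
  | 0, _, hw => hm hw
  | n + 1, _, hw => ⟨tanMap_mem_tanOver hm n hw.1, mem_univ _⟩

theorem tanIter_prod {E F G : Type*} (a : (k : ℕ) → IterTan k E → F)
    (b : (k : ℕ) → IterTan k E → G) : (n k : ℕ) → (w : IterTan k (IterTan n E)) →
    tanIter n (fun k w => (a k w, b k w)) k w = zip n (tanIter n a k w) (tanIter n b k w)
  | 0, _, _ => rfl
  | n + 1, _, _ => Prod.ext (tanIter_prod a b n _ _) (tanIter_prod a b n _ _)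

variable {E F G : Type*} [AddCommGroup E] [Module ℝ E] [TopologicalSpace E]
  [AddCommGroup F] [Module ℝ F] [TopologicalSpace F]
  [AddCommGroup G] [Module ℝ G] [TopologicalSpace G]

theorem tanIter_add_smul (a b : (k : ℕ) → IterTan k E → F) (t : ℝ) :
    (n k : ℕ) → (w : IterTan k (IterTan n E)) →
    tanIter n (fun k w => a k w + t • b k w) k w = tanIter n a k w + t • tanIter n b k w
  | 0, _, _ => rfl
  | n + 1, _, _ => Prod.ext (tanIter_add_smul a b t n _ _) (tanIter_add_smul a b t n _ _)

theorem tanIter_id : (n k : ℕ) → (w : IterTan k (IterTan n E)) →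
    tanIter n (idTower E) k w = idTower (IterTan n E) k w
  | 0, _, _ => rfl
  | n + 1, k, w =>
    (Prod.ext (tanIter_id n _ _) (tanIter_id n _ _) :
      (tanIter n (idTower E) k (map Prod.fst k w),
        tanIter n (idTower E) (k + 1) (map Prod.fst k w, map Prod.snd k w)) =
      (idTower (IterTan n E) k (map Prod.fst k w),
        idTower (IterTan n E) (k + 1) (map Prod.fst k w, map Prod.snd k w))).trans
      (idTower_prod (E := IterTan n E) (F := IterTan n E) k w)

theorem tanMap_prod (a : (k : ℕ) → IterTan k E → F) (b : (k : ℕ) → IterTan k E → G) (n : ℕ)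
    (w : IterTan n E) :
    tanMap n (fun k w => (a k w, b k w)) w = zip n (tanMap n a w) (tanMap n b w) :=
  tanIter_prod a b n 0 w

theorem tanMap_add_smul (a b : (k : ℕ) → IterTan k E → F) (t : ℝ) (n : ℕ) (w : IterTan n E) :
    tanMap n (fun k w => a k w + t • b k w) w = tanMap n a w + t • tanMap n b w :=
  tanIter_add_smul a b t n 0 w

theorem tanMap_id (n : ℕ) (w : IterTan n E) : tanMap n (idTower E) w = w :=
  tanIter_id n 0 w

variable [IsTopologicalAddGroup E] [ContinuousSMul ℝ E]
  [IsTopologicalAddGroup F] [ContinuousSMul ℝ F] [LocallyConvexSpace ℝ F] [T2Space F]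

/-- The first component is f composed with a projection, and the second is df, whose tower is
supplied by `shift`. -/
theorem IsDiffTower.tangent {f : E → F} {A : Set E} {h : (k : ℕ) → IterTan k E → F}
    (hA : A ⊆ closure (interior A)) (hf : IsDiffTower f A h) :
    IsDiffTower (tanSeq h 0) (A ×ˢ univ) (tanSeq h) := by
  refine ⟨rfl, ?_⟩
  have h₁ := hf.comp_clm (ContinuousLinearMap.fst ℝ E E) (A := A ×ˢ univ) (fun p hp => hp.1)
    (by rw [interior_prod_eq]; exact fun p hp => hp.1)
  exact (h₁.prodMk (hf.shift hA)).succ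

theorem IsDiffTower.iterTangent {f : E → F} {A : Set E} {h : (k : ℕ) → IterTan k E → F}
    (hA : A ⊆ closure (interior A)) (hf : IsDiffTower f A h) :
    (n : ℕ) → IsDiffTower (tanIter n h 0) (tanOver A n) (tanIter n h)
  | 0 => ⟨rfl, hf.succ⟩
  | n + 1 => (IsDiffTower.iterTangent hA hf n).tangent (tanOver_subset_closure_interior hA n)

theorem IsDiffTower.continuousOn_tanMap {f : E → F} {A : Set E} {h : (k : ℕ) → IterTan k E → F}
    (hA : A ⊆ closure (interior A)) (hf : IsDiffTower f A h) (n : ℕ) :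
    ContinuousOn (tanMap n h) (tanOver A n) :=
  (hf.iterTangent hA n).continuousOn 0

/-- Faà di Bruno's formula: the `n`-th differential of a composition. -/
theorem IsDiffTower.comp {f : F → G} {V : Set F} {a : (n : ℕ) → IterTan n F → G} {g : E → F}
    {A : Set E} {b : (n : ℕ) → IterTan n E → F} [IsTopologicalAddGroup G] [ContinuousSMul ℝ G]
    [LocallyConvexSpace ℝ G] (hf : IsDiffTower f V a) (hg : IsDiffTower g A b)
    (hV : V ⊆ closure (interior V)) (hA : A ⊆ closure (interior A)) (hm : MapsTo g A V)
    (hmi : MapsTo g (interior A) (interior V)) :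
    IsDiffTower (fun x => f (g x)) A (fun n w => a n (tanMap n b w)) where
  zero := by
    rw [hf.zero, ← hg.zero]; rfl
  succ n := by
    rw [← hg.zero] at hm hmi
    -- The chain rule for aₙ ∘ Tⁿg evaluates aₙ₊₁ at the pair of Tⁿg and its differential, and this
    -- pair is Tⁿ⁺¹g by definition.
    refine (hf.succ n).comp ((hg.iterTangent hA n).succ 0) (tanOver_subset_closure_interior hV n)
      (tanMap_mem_tanOver hm n) ?_
    show MapsTo _ (interior (tanOver A n)) _
    rw [interior_tanOver, interior_tanOver]
    exact tanMap_mem_tanOver hmi n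

end Tangent

/-! ### Partial differentials of maps on products -/

namespace IterTan

variable {X E : Type*} [AddCommGroup X]

theorem map_fst_partial : (n : ℕ) → (w : IterTan n X) → (b c : IterTan n E) →
    map Prod.fst n (map (fun p : X × (E × E) => ((p.1, p.2.1), ((0 : X), p.2.2))) n
      (zip n w (zip n b c))) = zip n w b
  | 0, _, _, _ => rfl
  | n + 1, w, b, c =>
    Prod.ext (map_fst_partial n w.1 b.1 c.1) (map_fst_partial n w.2 b.2 c.2)

theorem map_snd_partial : (n : ℕ) → (w : IterTan n X) → (b c : IterTan n E) →
    map Prod.snd n (map (fun p : X × (E × E) => ((p.1, p.2.1), ((0 : X), p.2.2))) n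
      (zip n w (zip n b c))) = zip n (0 : IterTan n X) c
  | 0, _, _, _ => rfl
  | n + 1, w, b, c =>
    Prod.ext (map_snd_partial n w.1 b.1 c.1) (map_snd_partial n w.2 b.2 c.2)

end IterTan

section Partial

variable {X E F : Type*} [AddCommGroup X] [Module ℝ X] [TopologicalSpace X]
  [IsTopologicalAddGroup X] [ContinuousSMul ℝ X] [LocallyConvexSpace ℝ X] [T2Space X]
  [AddCommGroup E] [Module ℝ E] [TopologicalSpace E]
  [IsTopologicalAddGroup E] [ContinuousSMul ℝ E] [LocallyConvexSpace ℝ E] [T2Space E]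
  [AddCommGroup F] [Module ℝ F] [TopologicalSpace F]
  [IsTopologicalAddGroup F] [ContinuousSMul ℝ F] [LocallyConvexSpace ℝ F] [T2Space F]

theorem prod_subset_closure_interior {T : Set X} {U : Set E} (hT : T ⊆ closure (interior T))
    (hU : IsOpen U) : T ×ˢ U ⊆ closure (interior (T ×ˢ U)) := by
  rw [interior_prod_eq, closure_prod_eq, hU.interior_eq]
  exact prod_mono hT subset_closure

theorem IsDiffTower.comp_graph {f : X × E → F} {T : Set X} {U : Set E}
    {a : (n : ℕ) → IterTan n (X × E) → F} {g : X → E} {b : (n : ℕ) → IterTan n X → E}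
    (hT : T ⊆ closure (interior T)) (hU : IsOpen U) (hf : IsDiffTower f (T ×ˢ U) a)
    (hg : IsDiffTower g T b) (hm : MapsTo g T U) :
    IsDiffTower (fun x => f (x, g x)) T (fun n w => a n (zip n w (tanMap n b w))) := by
  have h := hf.comp ((isDiffTower_id T).prodMk hg) (prod_subset_closure_interior hT hU) hT
    (fun x hx => ⟨hx, hm hx⟩) (by
      rw [interior_prod_eq, hU.interior_eq]
      exact fun x hx => ⟨hx, hm (interior_subset hx)⟩)
  simp only [tanMap_prod, tanMap_id] at h
  exact h

/-- The partial differential is df after the linear insertion (x, y, v) ↦ ((x, y), (0, v)), so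
`shift` provides its tower. -/
theorem IsDiffTower.partialSnd {f : X × E → F} {T : Set X} {U : Set E}
    {a : (n : ℕ) → IterTan n (X × E) → F} (hT : T ⊆ closure (interior T)) (hU : IsOpen U)
    (hf : IsDiffTower f (T ×ˢ U) a) :
    IsDiffTower (fun p : X × (E × E) => a 1 ((p.1, p.2.1), ((0 : X), p.2.2))) (T ×ˢ (U ×ˢ univ))
      (fun n w => a (n + 1)
        (map Prod.fst n (map (fun p : X × (E × E) => ((p.1, p.2.1), ((0 : X), p.2.2))) n w),
         map Prod.snd n (map (fun p : X × (E × E) => ((p.1, p.2.1), ((0 : X), p.2.2))) n w))) := by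
  have hS := hf.shift (prod_subset_closure_interior hT hU)
  refine hS.comp_clm (((ContinuousLinearMap.fst ℝ X (E × E)).prod
    ((ContinuousLinearMap.fst ℝ E E).comp (ContinuousLinearMap.snd ℝ X (E × E)))).prod
    ((0 : X × (E × E) →L[ℝ] X).prod
    ((ContinuousLinearMap.snd ℝ E E).comp (ContinuousLinearMap.snd ℝ X (E × E)))))
    (fun p hp => ⟨⟨hp.1, hp.2.1⟩, mem_univ _⟩) ?_
  simp only [interior_prod_eq]
  exact fun p hp => ⟨⟨hp.1, hp.2.1⟩, by simp⟩

/-- This puts the n-th differential of d₂f ∘ (id, g, k) in exactly the form of the limit in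
`tendsto_slope_snd`. -/
theorem IsDiffTower.comp_graph_partialSnd {f : X × E → F} {T : Set X} {U : Set E}
    {a : (n : ℕ) → IterTan n (X × E) → F} {g k : X → E} {b c : (n : ℕ) → IterTan n X → E}
    (hT : T ⊆ closure (interior T)) (hU : IsOpen U) (hf : IsDiffTower f (T ×ˢ U) a)
    (hg : IsDiffTower g T b) (hk : IsDiffTower k T c) (hm : MapsTo g T U) :
    IsDiffTower (fun x => a 1 ((x, g x), ((0 : X), k x))) T
      (fun n w => a (n + 1) (zip n w (tanMap n b w),
        zip n (0 : IterTan n X) (tanMap n c w))) := by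
  have h := (hf.partialSnd hT hU).comp_graph hT (hU.prod isOpen_univ) (hg.prodMk hk)
    fun x hx => ⟨hm hx, mem_univ _⟩
  simp only [tanMap_prod, map_fst_partial, map_snd_partial] at h
  exact h

/-- Difference quotients in the second variable converge, also over boundary points in the first
variable. -/
theorem IsDiffTower.tendsto_slope_snd {f : X × E → F} {T : Set X} {U : Set E}
    {a : (n : ℕ) → IterTan n (X × E) → F} (hT : T ⊆ closure (interior T)) (hU : IsOpen U)
    (hf : IsDiffTower f (T ×ˢ U) a) {n : ℕ} {w₀ : IterTan n X} (hw₀ : w₀ ∈ tanOver T n)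
    {b₀ : IterTan n E} (hb₀ : b₀ ∈ tanOver U n) (c₀ : IterTan n E) :
    Tendsto (fun p : ℝ × (IterTan n X × (IterTan n E × IterTan n E)) =>
        p.1⁻¹ • (a n (zip n p.2.1 (p.2.2.1 + p.1 • p.2.2.2)) - a n (zip n p.2.1 p.2.2.1)))
      (𝓝[≠] 0 ×ˢ (𝓝[tanOver T n] w₀ ×ˢ (𝓝 b₀ ×ˢ 𝓝 c₀)))
      (𝓝 (a (n + 1) (zip n w₀ b₀, zip n (0 : IterTan n X) c₀))) := by
  have hzip (w : IterTan n X) (b c : IterTan n E) (t : ℝ) :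
      zip n w b + t • zip n (0 : IterTan n X) c = zip n w (b + t • c) := by
    rw [← zip_add_smul, smul_zero, add_zero]
  -- Directions are restricted to those with vanishing X-component. Then the X-part of a segment is
  -- constant and its E-part starts in an open set, so short segments stay in the domain even over
  -- boundary points of `T`.
  have h := (hf.succ n).tendsto_slope (y₀ := zip n w₀ b₀) (u₀ := zip n (0 : IterTan n X) c₀)
    (Z := range (zip n (0 : IterTan n X)))
    (tanOver_subset_closure_interior (prod_subset_closure_interior hT hU) n)
    (zip_mem_tanOver n hw₀ hb₀) ?_
  · have hmap : Tendsto (fun p : ℝ × (IterTan n X × (IterTan n E × IterTan n E)) =>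
        (p.1, (zip n p.2.1 p.2.2.1, zip n (0 : IterTan n X) p.2.2.2)))
        (𝓝[≠] 0 ×ˢ (𝓝[tanOver T n] w₀ ×ˢ (𝓝 b₀ ×ˢ 𝓝 c₀)))
        (𝓝[≠] 0 ×ˢ (𝓝[tanOver (T ×ˢ U) n] (zip n w₀ b₀) ×ˢ
          𝓝[range (zip n (0 : IterTan n X))] (zip n (0 : IterTan n X) c₀))) := by
      refine tendsto_fst.prodMk (Tendsto.prodMk ?_ ?_)
      · have h₁ : Tendsto (fun q : IterTan n X × (IterTan n E × IterTan n E) => zip n q.1 q.2.1)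
            (𝓝[tanOver T n] w₀ ×ˢ (𝓝 b₀ ×ˢ 𝓝 c₀)) (𝓝[tanOver (T ×ˢ U) n] (zip n w₀ b₀)) := by
          refine tendsto_nhdsWithin_iff.2 ⟨?_, ?_⟩
          · have := ((continuous_zip (E := X) (F := E) n).tendsto (w₀, b₀))
            rw [nhds_prod_eq] at this
            exact this.comp ((tendsto_fst.mono_right nhdsWithin_le_nhds).prodMk
              (tendsto_fst.comp tendsto_snd))
          · filter_upwards [tendsto_fst.eventually (eventually_mem_nhdsWithin (a := w₀)),
              (tendsto_fst.comp tendsto_snd).eventually_mem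
                ((isOpen_tanOver hU n).mem_nhds hb₀)] with q hq hq'
            exact zip_mem_tanOver n hq hq'
        exact h₁.comp tendsto_snd
      · refine tendsto_nhdsWithin_iff.2 ⟨?_, Eventually.of_forall fun _ => mem_range_self _⟩
        have := ((continuous_zip (E := X) (F := E) n).comp
          ((continuous_const (y := (0 : IterTan n X))).prodMk continuous_id)).tendsto c₀
        exact this.comp (tendsto_snd.comp (tendsto_snd.comp tendsto_snd))
    refine (h.comp hmap).congr fun p => ?_
    simp only [Function.comp_apply, hzip]
  · have h₁ : ∀ᶠ p : ℝ × IterTan n (X × E) × IterTan n (X × E) in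
        𝓝 (0, zip n w₀ b₀, zip n (0 : IterTan n X) c₀),
        map Prod.snd n p.2.1 + p.1 • map Prod.snd n p.2.2 ∈ tanOver U n := by
      have hc := continuous_map (continuous_snd (X := X) (Y := E)) n
      have : Continuous fun p : ℝ × IterTan n (X × E) × IterTan n (X × E) =>
          map Prod.snd n p.2.1 + p.1 • map Prod.snd n p.2.2 := by fun_prop
      refine this.continuousAt.eventually_mem ((isOpen_tanOver hU n).mem_nhds ?_)
      simpa [map_snd_zip] using hb₀
    rw [nhds_prod_eq, nhds_prod_eq] at h₁
    have h₂ := h₁.filter_mono (Filter.prod_mono le_rfl (Filter.prod_mono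
      (nhdsWithin_le_nhds (s := tanOver (T ×ˢ U) n))
      (nhdsWithin_le_nhds (s := range (zip n (0 : IterTan n X))))))
    have h₃ : ∀ᶠ p : ℝ × IterTan n (X × E) × IterTan n (X × E) in
        𝓝 (0 : ℝ) ×ˢ (𝓝[tanOver (T ×ˢ U) n] (zip n w₀ b₀) ×ˢ
          𝓝[range (zip n (0 : IterTan n X))] (zip n (0 : IterTan n X) c₀)),
        p.2.1 ∈ tanOver (T ×ˢ U) n ∧ p.2.2 ∈ range (zip n (0 : IterTan n X)) :=
      tendsto_snd.eventually (eventually_mem_nhdsWithin.prod_mk eventually_mem_nhdsWithin)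
    filter_upwards [h₂, h₃]
    rintro ⟨t, y, u⟩ hp ⟨hy, c, rfl⟩
    rw [map_snd_zip] at hp
    have hy' : map Prod.fst n y ∈ tanOver T n := map_mem_tanOver (fun q hq => hq.1) n hy
    show y + t • zip n (0 : IterTan n X) c ∈ _
    rw [← zip_map_fst_map_snd n y, hzip]
    exact zip_mem_tanOver n hy' hp

end Partial

/-! ### Convergence on compact sets -/

section CompactConvergence

variable {T Y F : Type*} [TopologicalSpace Y] [TopologicalSpace F]

/-- Convergence in the compact-open topology means joint convergence over each compact set. -/
theorem tendsto_compactOpen_iff [T2Space Y] [RegularSpace F] {A : Set Y} {Φ : T → C(A, F)}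
    {g : C(A, F)} {φ : T → Y → F} {ψ : Y → F} (hφ : ∀ t (a : A), Φ t a = φ t a)
    (hψ : ∀ a : A, g a = ψ a) {l : Filter T} :
    Tendsto Φ l (𝓝 g) ↔ ∀ K : Set Y, IsCompact K → K ⊆ A → ∀ y₀ ∈ K,
      Tendsto (fun p : T × Y => φ p.1 p.2) (l ×ˢ 𝓝[K] y₀) (𝓝 (ψ y₀)) := by
  have hcont : ContinuousOn ψ A := continuousOn_iff_continuous_domRestrict.2 (by
    convert g.continuous using 1
    exact (funext hψ).symm)
  rw [ContinuousMap.tendsto_nhds_compactOpen]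
  constructor
  · intro H K hK hKA y₀ hy₀ W hW
    -- Since `D` is closed, K ∩ ψ⁻¹(D) is compact while still a neighbourhood of `y₀` in `K`; it is
    -- the compact set on which the compact-open topology is tested.
    obtain ⟨D, hD, hDc, hDW⟩ := exists_mem_nhds_isClosed_subset (interior_mem_nhds.2 hW)
    have hC : IsCompact (K ∩ ψ ⁻¹' D) := hK.of_isClosed_subset
      ((hcont.mono hKA).preimage_isClosed_of_isClosed hK.isClosed hDc) inter_subset_left
    have hCA : (Subtype.val '' (Subtype.val ⁻¹' (K ∩ ψ ⁻¹' D) : Set A)) = K ∩ ψ ⁻¹' D := by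
      rw [Subtype.image_preimage_coe]
      exact inter_eq_right.2 (inter_subset_left.trans hKA)
    have hev := H (Subtype.val ⁻¹' (K ∩ ψ ⁻¹' D)) (by rw [Subtype.isCompact_iff, hCA]; exact hC)
      (interior W) isOpen_interior fun a ha => by rw [hψ]; exact hDW ha.2
    have hC' : K ∩ ψ ⁻¹' D ∈ 𝓝[K] y₀ :=
      inter_mem self_mem_nhdsWithin (((hcont y₀ (hKA hy₀)).mono hKA).tendsto hD)
    refine mem_map.2 ?_
    filter_upwards [hev.prod_mk hC']
    rintro ⟨t, y⟩ ⟨ht, hy⟩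
    have := ht (x := ⟨y, hKA hy.1⟩) hy
    rw [hφ] at this
    exact (interior_subset this : φ t y ∈ W)
  · intro H K hK W hW hm
    -- The property passes to subsets and finite unions, so on a compact set it suffices to have it
    -- locally.
    have key : ∀ᶠ t in l, ∀ y ∈ Subtype.val '' K, φ t y ∈ W := by
      refine (hK.image continuous_subtype_val).induction_on
        (p := fun s => ∀ᶠ t in l, ∀ y ∈ s, φ t y ∈ W) (by simp)
        (fun s s' hs h => h.mono fun t ht y hy => ht y (hs hy))
        (fun s s' h h' => (h.and h').mono fun t ht y hy => hy.elim (ht.1 y) (ht.2 y)) ?_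
      intro y hy
      have hyW : ψ y ∈ W := by
        obtain ⟨a, ha, rfl⟩ := hy
        rw [← hψ]; exact hm ha
      obtain ⟨pa, hpa, pb, hpb, h⟩ := eventually_prod_iff.1
        ((H _ (hK.image continuous_subtype_val) (by simp) y hy).eventually_mem (hW.mem_nhds hyW))
      exact ⟨{y | pb y}, hpb, hpa.mono fun t ht y hy => h ht hy⟩
    filter_upwards [key] with t ht a ha
    rw [hφ]
    exact ht _ ⟨a, ha, rfl⟩

/-- If a family of towers converges uniformly on compact sets, so do the iterated tangent maps. -/
theorem tendsto_tanIter {X E : Type*} [TopologicalSpace X] [TopologicalSpace E]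
    {l : Filter T} {h : T → (k : ℕ) → IterTan k X → E} {h₀ : (k : ℕ) → IterTan k X → E} {A : Set X}
    (H : ∀ k, ∀ K : Set (IterTan k X), IsCompact K → K ⊆ tanOver A k → ∀ w₀ ∈ K,
      Tendsto (fun p : T × IterTan k X => h p.1 k p.2) (l ×ˢ 𝓝[K] w₀) (𝓝 (h₀ k w₀))) :
    ∀ n k, ∀ K : Set (IterTan k (IterTan n X)), IsCompact K → K ⊆ tanOver (tanOver A n) k →
      ∀ w₀ ∈ K, Tendsto (fun p : T × IterTan k (IterTan n X) => tanIter n (h p.1) k p.2)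
        (l ×ˢ 𝓝[K] w₀) (𝓝 (tanIter n h₀ k w₀))
  | 0 => H
  | n + 1 => by
    intro k K hK hKA w₀ hw₀
    have hc₁ : Continuous (map (Prod.fst : IterTan n X × IterTan n X → IterTan n X) k) :=
      continuous_map continuous_fst k
    have hc₂ : Continuous (fun w : IterTan k (IterTan n X × IterTan n X) =>
        ((map Prod.fst k w, map Prod.snd k w) : IterTan (k + 1) (IterTan n X))) :=
      hc₁.prodMk (continuous_map continuous_snd k)
    have hm : ∀ w ∈ K, map (Prod.fst : IterTan n X × IterTan n X → IterTan n X) k w ∈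
        tanOver (tanOver A n) k :=
      fun w hw => map_mem_tanOver (fun p hp => hp.1) k (hKA hw)
    have key : ∀ (j : ℕ) (q : IterTan k (IterTan n X × IterTan n X) → IterTan j (IterTan n X)),
        Continuous q → (∀ w ∈ K, q w ∈ tanOver (tanOver A n) j) →
        Tendsto (fun p : T × IterTan k (IterTan n X × IterTan n X) => tanIter n (h p.1) j (q p.2))
        (l ×ˢ 𝓝[K] w₀) (𝓝 (tanIter n h₀ j (q w₀))) := by
      intro j q hq hqm
      refine (tendsto_tanIter H n j (q '' K) (hK.image hq) (image_subset_iff.2 hqm) (q w₀)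
        (mem_image_of_mem q hw₀)).comp
        (f := fun p : T × IterTan k (IterTan n X × IterTan n X) => (p.1, q p.2)) ?_
      exact tendsto_fst.prodMk ((hq.continuousWithinAt.tendsto_nhdsWithin
        (mapsTo_image q K)).comp tendsto_snd)
    exact (key k _ hc₁ hm).prodMk_nhds (key (k + 1) _ hc₂ fun w hw => ⟨hm w hw, mem_univ _⟩)

end CompactConvergence

/-! ### The topological vector space of smooth maps -/

section Space

variable {X M E F : Type*} [AddCommGroup X] [Module ℝ X] [TopologicalSpace X]
  [IsTopologicalAddGroup X] [ContinuousSMul ℝ X] [T2Space X] [TopologicalSpace M]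
  [AddCommGroup E] [Module ℝ E] [TopologicalSpace E]
  [IsTopologicalAddGroup E] [ContinuousSMul ℝ E] [T2Space E]
  [AddCommGroup F] [Module ℝ F] [TopologicalSpace F]
  [IsTopologicalAddGroup F] [ContinuousSMul ℝ F] [T2Space F]

theorem CornerStructure.target_subset_closure_interior (S : CornerStructure X M)
    (e : CornerChart M (cornerSet S.functional)) : e.target ⊆ closure (interior e.target) := by
  obtain ⟨O, hO, he⟩ := e.target_eq
  rw [he, interior_inter, hO.interior_eq]
  exact fun x hx => hO.inter_closure ⟨hx.1, S.dense_interior hx.2⟩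

/-- The higher differentials of a map in a chart. -/
noncomputable def localDiff {P : Set X} (e : CornerChart M P) (γ : M → F) (n : ℕ) : IterTan n X → F :=
  iterDiff (fun x => γ (e.invFun x)) e.target n

namespace SmoothMap

variable {S : CornerStructure X M} {e : CornerChart M (cornerSet S.functional)}

theorem ext {γ η : SmoothMap S F} (h : ∀ x, γ x = η x) : γ = η := Subtype.ext (funext h)

theorem isDiffTower_localDiff (γ : SmoothMap S F) (he : e ∈ S.charts) :
    IsDiffTower (fun x => γ (e.invFun x)) e.target (localDiff e γ) :=
  (γ.2 e he).isDiffTower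

theorem localDiff_eqOn (e : CornerChart M (cornerSet S.functional)) (γ : M → F)
    {a : (n : ℕ) → IterTan n X → F}
    (ha : IsDiffTower (fun x => γ (e.invFun x)) e.target a) (n : ℕ) :
    EqOn (localDiff e γ n) (a n) (tanOver e.target n) :=
  ha.iterDiff_eqOn (S.target_subset_closure_interior e) n

theorem localDiff_add_smul_eqOn (he : e ∈ S.charts) (γ η : SmoothMap S F) (t : ℝ) (n : ℕ) :
    EqOn (localDiff e (γ + t • η : SmoothMap S F) n)
      (fun w => localDiff e γ n w + t • localDiff e η n w) (tanOver e.target n) :=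
  localDiff_eqOn e (γ + t • η : SmoothMap S F)
    ((γ.isDiffTower_localDiff he).add_smul (η.isDiffTower_localDiff he) t) n

/-- Joint convergence in parameter and point is preferred to uniform convergence because it composes
directly with continuous maps. -/
theorem tendsto_iff {T : Type*} {Φ : T → SmoothMap S F} {l : Filter T} {γ : SmoothMap S F} :
    Tendsto Φ l (𝓝 γ) ↔ ∀ e ∈ S.charts, ∀ n, ∀ K : Set (IterTan n X), IsCompact K →
      K ⊆ tanOver e.target n → ∀ w₀ ∈ K,
      Tendsto (fun p : T × IterTan n X => localDiff e (Φ p.1) n p.2) (l ×ˢ 𝓝[K] w₀)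
        (𝓝 (localDiff e γ n w₀)) := by
  have : 𝓝 γ = ⨅ (e : S.charts) (n : ℕ), comap (chartDiff e n) (𝓝 (chartDiff e n γ)) := by
    refine nhds_iInf.trans (iInf_congr fun e => nhds_iInf.trans (iInf_congr fun n => ?_))
    exact nhds_induced _ _
  rw [this]
  simp only [tendsto_iInf, tendsto_comap_iff, Subtype.forall]
  refine forall₃_congr fun e he n => ?_
  exact tendsto_compactOpen_iff (φ := fun t w => localDiff e (Φ t) n w) (ψ := localDiff e γ n)
    (fun _ _ => rfl) fun _ => rfl

/-- `localDiff` is a chosen tower; uniqueness allows explicit formulas, valid only over the chart,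
to be used in its place. -/
theorem tendsto_of_eqOn {T : Type*} {Φ : T → SmoothMap S F} {l : Filter T} {γ : SmoothMap S F}
    (H : ∀ e ∈ S.charts, ∀ n, ∃ (a : T → IterTan n X → F) (a₀ : IterTan n X → F),
      (∀ᶠ t in l, EqOn (localDiff e (Φ t) n) (a t) (tanOver e.target n)) ∧
      EqOn (localDiff e γ n) a₀ (tanOver e.target n) ∧
      ∀ K : Set (IterTan n X), IsCompact K → K ⊆ tanOver e.target n → ∀ w₀ ∈ K,
        Tendsto (fun p : T × IterTan n X => a p.1 p.2) (l ×ˢ 𝓝[K] w₀) (𝓝 (a₀ w₀))) :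
    Tendsto Φ l (𝓝 γ) := by
  rw [tendsto_iff]
  intro e he n K hK hKA w₀ hw₀
  obtain ⟨a, a₀, ha, ha₀, h⟩ := H e he n
  rw [ha₀ (hKA hw₀)]
  refine (h K hK hKA w₀ hw₀).congr' ?_
  filter_upwards [ha.prod_mk (self_mem_nhdsWithin (a := w₀) (s := K))] with p hp
  exact (hp.1 (hKA hp.2)).symm

theorem tendsto_localDiff (γ : SmoothMap S F) (he : e ∈ S.charts) (n : ℕ) {K : Set (IterTan n X)}
    (hK : IsCompact K) (hKA : K ⊆ tanOver e.target n) {w₀ : IterTan n X} (hw₀ : w₀ ∈ K) :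
    Tendsto (fun p : SmoothMap S F × IterTan n X => localDiff e p.1 n p.2) (𝓝 γ ×ˢ 𝓝[K] w₀)
      (𝓝 (localDiff e γ n w₀)) :=
  tendsto_iff.1 (tendsto_id (x := 𝓝 γ)) e he n K hK hKA w₀ hw₀

variable (S) in
/-- The `n`-th differential in a chart, as a linear map. -/
noncomputable def chartDiffLinear (F : Type*) [AddCommGroup F] [Module ℝ F] [TopologicalSpace F]
    [IsTopologicalAddGroup F] [ContinuousSMul ℝ F] [T2Space F] (e : S.charts) (n : ℕ) :
    SmoothMap S F →ₗ[ℝ] C(tanOver e.1.target n, F) where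
  toFun := chartDiff e n
  map_add' γ η := by
    ext w
    have h := localDiff_add_smul_eqOn e.2 γ η 1 n w.2
    simp only [one_smul] at h
    exact h
  map_smul' t γ := by
    ext w
    have h₀ : localDiff e.1 (0 : SmoothMap S F) n w = 0 :=
      localDiff_eqOn e.1 (0 : SmoothMap S F) (isDiffTower_zero e.1.target) n w.2
    have h := localDiff_add_smul_eqOn e.2 0 γ t n w.2
    simp only [h₀, zero_add] at h
    exact h

/-- The topology is initial for linear maps into topological vector spaces. -/
instance : IsTopologicalAddGroup (SmoothMap S F) :=
  topologicalAddGroup_iInf fun e => topologicalAddGroup_iInf fun n =>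
    topologicalAddGroup_induced (chartDiffLinear S F e n)

instance : ContinuousSMul ℝ (SmoothMap S F) :=
  continuousSMul_iInf fun e => continuousSMul_iInf fun n =>
    continuousSMul_induced (chartDiffLinear S F e n)

theorem localDiff_zero_apply (γ : SmoothMap S F) (he : e ∈ S.charts) {m : M} (hm : m ∈ e.source) :
    localDiff e γ 0 (e.toFun m) = γ m := by
  rw [(γ.isDiffTower_localDiff he).zero]
  show γ (e.invFun (e.toFun m)) = γ m
  rw [e.left_inv' hm]

theorem tendsto_eval (γ : SmoothMap S F) (m : M) :
    Tendsto (fun η : SmoothMap S F => η m) (𝓝 γ) (𝓝 (γ m)) := by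
  obtain ⟨e, he, hm⟩ := S.cover m
  have h := γ.tendsto_localDiff he 0 (isCompact_singleton (x := e.toFun m))
    (singleton_subset_iff.2 (e.map_source' hm)) rfl
  rw [localDiff_zero_apply γ he hm] at h
  refine (h.comp (tendsto_id.prodMk (tendsto_const_pure.mono_right
    (pure_le_nhdsWithin (mem_singleton (e.toFun m)))))).congr fun η => ?_
  exact localDiff_zero_apply η he hm

instance : T2Space (SmoothMap S F) :=
  .of_injective_continuous (f := fun (γ : SmoothMap S F) (m : M) => γ m) Subtype.val_injective
    (continuous_pi fun m => continuous_iff_continuousAt.2 fun γ => γ.tendsto_eval m)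

/-- Only order 0 matters: a compact neighbourhood of `m` inside a chart domain has compact image in
the chart, where convergence is joint. -/
theorem tendsto_uncurry [T2Space M] [CompactSpace M] (γ : SmoothMap S F) (m : M) :
    Tendsto (fun p : SmoothMap S F × M => p.1 p.2) (𝓝 (γ, m)) (𝓝 (γ m)) := by
  obtain ⟨e, he, hm⟩ := S.cover m
  obtain ⟨K, hK, hKe, hKc⟩ := local_compact_nhds (e.isOpen_source.mem_nhds hm)
  have hc : ContinuousOn e.toFun K := e.continuousOn_toFun.mono hKe
  have h := γ.tendsto_localDiff he 0 (hKc.image_of_continuousOn hc)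
    (image_subset_iff.2 fun x hx => e.map_source' (hKe hx)) (mem_image_of_mem _ (mem_of_mem_nhds hK))
  rw [localDiff_zero_apply γ he hm] at h
  have ht : Tendsto e.toFun (𝓝 m) (𝓝[e.toFun '' K] (e.toFun m)) := by
    refine tendsto_nhdsWithin_iff.2 ⟨?_, mem_of_superset hK fun x hx => mem_image_of_mem _ hx⟩
    exact hc.continuousAt hK
  rw [nhds_prod_eq]
  refine (h.comp (tendsto_fst.prodMk (ht.comp tendsto_snd))).congr' ?_
  filter_upwards [tendsto_snd.eventually_mem hK] with p hp
  exact localDiff_zero_apply p.1 he (hKe hp)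

/-- By joint continuity, η(m') ∈ U for (η, m') near each (γ, m); compactness of `M` makes the
neighbourhood of γ uniform in m. -/
theorem isOpen_into [T2Space M] [CompactSpace M] {U : Set F} (hU : IsOpen U) :
    IsOpen (into S U) := by
  rw [isOpen_iff_mem_nhds]
  intro γ hγ
  have := isCompact_univ.eventually_forall_of_forall_eventually (x₀ := γ)
    (P := fun (η : SmoothMap S F) (m : M) => η m ∈ U) fun m _ =>
    (γ.tendsto_uncurry m).eventually_mem (hU.mem_nhds (hγ m))
  filter_upwards [this] with η hη m using hη m (mem_univ m)

/-- The pairing of two smooth maps. -/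
def prodMk (γ : SmoothMap S E) (η : SmoothMap S F) : SmoothMap S (E × F) :=
  ⟨fun x => (γ x, η x), fun _ he =>
    ((γ.isDiffTower_localDiff he).prodMk (η.isDiffTower_localDiff he)).smoothOn⟩

theorem continuous_prodMk :
    Continuous fun p : SmoothMap S E × SmoothMap S F => p.1.prodMk p.2 := by
  rw [continuous_iff_continuousAt]
  rintro ⟨γ, η⟩
  refine tendsto_of_eqOn fun e he n =>
    ⟨fun p w => (localDiff e p.1 n w, localDiff e p.2 n w),
      fun w => (localDiff e γ n w, localDiff e η n w), Eventually.of_forall fun p => ?_, ?_, ?_⟩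
  · exact localDiff_eqOn e (p.1.prodMk p.2)
      ((p.1.isDiffTower_localDiff he).prodMk (p.2.isDiffTower_localDiff he)) n
  · exact localDiff_eqOn e (γ.prodMk η)
      ((γ.isDiffTower_localDiff he).prodMk (η.isDiffTower_localDiff he)) n
  · intro K hK hKA w₀ hw₀
    rw [nhds_prod_eq]
    refine Tendsto.prodMk_nhds ?_ ?_
    · exact (γ.tendsto_localDiff he n hK hKA hw₀).comp
        ((tendsto_fst.comp tendsto_fst).prodMk tendsto_snd)
    · exact (η.tendsto_localDiff he n hK hKA hw₀).comp
        ((tendsto_snd.comp tendsto_fst).prodMk tendsto_snd)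

end SmoothMap

end Space

/-! ### The map `f_♯` -/

section Sharp

variable {X M E F : Type*} [AddCommGroup X] [Module ℝ X] [TopologicalSpace X]
  [IsTopologicalAddGroup X] [ContinuousSMul ℝ X] [LocallyConvexSpace ℝ X] [T2Space X]
  [TopologicalSpace M]
  [AddCommGroup E] [Module ℝ E] [TopologicalSpace E]
  [IsTopologicalAddGroup E] [ContinuousSMul ℝ E] [LocallyConvexSpace ℝ E] [T2Space E]
  [AddCommGroup F] [Module ℝ F] [TopologicalSpace F]
  [IsTopologicalAddGroup F] [ContinuousSMul ℝ F] [LocallyConvexSpace ℝ F] [T2Space F]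

/-- The partial differential `d₂f : M × (U × E) → F`, computed in some chart. -/
noncomputable def partialSnd (S : CornerStructure X M) (f : M × E → F) (U : Set E) :
    M × (E × E) → F :=
  fun p => iterDiffSnd (S.cover p.1).choose f U 1 p.1 p.2

variable {S : CornerStructure X M} {e : CornerChart M (cornerSet S.functional)} {f : M × E → F}
  {U : Set E}

theorem IsSmoothProd.isDiffTower (hf : IsSmoothProd S f U) (he : e ∈ S.charts) :
    IsDiffTower (chartRep e f) (e.target ×ˢ U) (iterDiff (chartRep e f) (e.target ×ˢ U)) :=
  (hf e he).isDiffTower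

theorem IsSmoothProd.iterDiffSnd_zero (hf : IsSmoothProd S f U) (he : e ∈ S.charts) {m : M}
    (hm : m ∈ e.source) (y : E) : iterDiffSnd e f U 0 m y = f (m, y) := by
  show iterDiff (chartRep e f) (e.target ×ˢ U) 0 _ = _
  rw [(hf.isDiffTower he).zero]
  show f (e.invFun (e.toFun m), y) = f (m, y)
  rw [e.left_inv' hm]

/-- Over a boundary point `m` this limit is not part of the definition of smoothness. For n = 0 it
characterises d₂f without reference to a chart. -/
theorem IsSmoothProd.tendsto_iterDiffSnd (hU : IsOpen U) (hf : IsSmoothProd S f U)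
    (he : e ∈ S.charts) {m : M} (hm : m ∈ e.source) {n : ℕ} {w : IterTan n E}
    (hw : w ∈ tanOver U n) (v : IterTan n E) :
    Tendsto (fun h : ℝ => h⁻¹ • (iterDiffSnd e f U n m (w + h • v) - iterDiffSnd e f U n m w))
      (𝓝[≠] 0) (𝓝 (iterDiffSnd e f U (n + 1) m (w, v))) := by
  have hz := zeroAt_mem_tanOver (e.map_source' hm) n
  have h := (hf.isDiffTower he).tendsto_slope_snd (S.target_subset_closure_interior e) hU hz hw v
  refine (h.comp (tendsto_id.prodMk (Tendsto.prodMk ?_ (Tendsto.prodMk ?_ ?_)))).congr fun h => rfl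
  · exact tendsto_const_pure.mono_right (pure_le_nhdsWithin hz)
  · exact tendsto_const_nhds
  · exact tendsto_const_nhds

theorem IsSmoothProd.tendsto_slope_iterDiffSnd (hU : IsOpen U) (hf : IsSmoothProd S f U)
    (he : e ∈ S.charts) {m : M} (hm : m ∈ e.source) {y : E} (hy : y ∈ U) (v : E) :
    Tendsto (fun h : ℝ => h⁻¹ • (f (m, y + h • v) - f (m, y)))
      (𝓝[≠] 0) (𝓝 (iterDiffSnd e f U 1 m (y, v))) := by
  refine (hf.tendsto_iterDiffSnd hU he hm (n := 0) hy v).congr fun h => ?_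
  exact congrArg₂ (fun a b => h⁻¹ • (a - b)) (hf.iterDiffSnd_zero he hm (y + h • v))
    (hf.iterDiffSnd_zero he hm y)

theorem IsSmoothProd.tendsto_partialSnd (hU : IsOpen U) (hf : IsSmoothProd S f U) (m : M) {y : E}
    (hy : y ∈ U) (v : E) : Tendsto (fun h : ℝ => h⁻¹ • (f (m, y + h • v) - f (m, y)))
      (𝓝[≠] 0) (𝓝 (partialSnd S f U (m, (y, v)))) :=
  hf.tendsto_slope_iterDiffSnd hU (S.cover m).choose_spec.1 (S.cover m).choose_spec.2 hy v

/-- Independence of the chart: both sides are limits of the same difference quotients of f(m, ·). -/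
theorem IsSmoothProd.partialSnd_eq (hU : IsOpen U) (hf : IsSmoothProd S f U)
    (he : e ∈ S.charts) {x : X} (hx : x ∈ e.target) {y : E} (hy : y ∈ U) (v : E) :
    partialSnd S f U (e.invFun x, (y, v)) =
      iterDiff (chartRep e f) (e.target ×ˢ U) 1 ((x, y), ((0 : X), v)) := by
  refine (tendsto_nhds_unique (hf.tendsto_partialSnd hU _ hy v)
    (hf.tendsto_slope_iterDiffSnd hU he (e.map_target' hx) hy v)).trans ?_
  show iterDiff (chartRep e f) (e.target ×ˢ U) 1
    ((e.toFun (e.invFun x), y), ((0 : X), v)) = _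
  rw [e.right_inv' hx]

theorem IsSmoothProd.partialSnd (hU : IsOpen U) (hf : IsSmoothProd S f U) :
    IsSmoothProd S (partialSnd S f U) (U ×ˢ univ) := fun e he =>
  ((hf.isDiffTower he).partialSnd (S.target_subset_closure_interior e) hU).congr fun _ hp =>
    hf.partialSnd_eq hU he hp.1 hp.2.1 _

theorem IsSmoothProd.isDiffTower_graph (hU : IsOpen U) (hf : IsSmoothProd S f U)
    (he : e ∈ S.charts) {γ : M → E} (hγ : ∀ x, γ x ∈ U) {g : (n : ℕ) → IterTan n X → E}
    (hg : IsDiffTower (fun x => γ (e.invFun x)) e.target g) :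
    IsDiffTower (fun x => f (e.invFun x, γ (e.invFun x))) e.target
      (fun n w => iterDiff (chartRep e f) (e.target ×ˢ U) n (zip n w (tanMap n g w))) :=
  (hf.isDiffTower he).comp_graph (S.target_subset_closure_interior e) hU hg fun _ _ => hγ _

theorem IsSmoothProd.isSmooth_graph (hU : IsOpen U) (hf : IsSmoothProd S f U)
    {γ : SmoothMap S E} (hγ : γ ∈ SmoothMap.into S U) : IsSmooth S fun x => f (x, γ x) :=
  fun _ he => (hf.isDiffTower_graph hU he hγ (γ.isDiffTower_localDiff he)).smoothOn

/-! ### Continuity and first differential of f_♯ -/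

namespace SmoothMap

theorem ofFun_apply {h : M → F} (hs : IsSmooth S h) (x : M) : ofFun S h x = h x :=
  congrFun (congrArg Subtype.val (dif_pos hs : ofFun S h = ⟨h, hs⟩)) x

theorem sharp_apply (hU : IsOpen U) (hf : IsSmoothProd S f U) {γ : SmoothMap S E}
    (hγ : γ ∈ into S U) (x : M) : sharp S f γ x = f (x, γ x) :=
  ofFun_apply (hf.isSmooth_graph hU hγ) x

/-- The tower `g` is left free so that for γ + hη one can insert the sum of the towers of γ and η,
on which `tanMap` is linear. -/
theorem localDiff_sharp_eqOn (hU : IsOpen U) (hf : IsSmoothProd S f U) (he : e ∈ S.charts)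
    {γ : SmoothMap S E} (hγ : γ ∈ into S U) {g : (n : ℕ) → IterTan n X → E}
    (hg : IsDiffTower (fun x => γ (e.invFun x)) e.target g) (n : ℕ) :
    EqOn (localDiff e (sharp S f γ) n)
      (fun w => iterDiff (chartRep e f) (e.target ×ˢ U) n (zip n w (tanMap n g w)))
      (tanOver e.target n) :=
  ((sharp S f γ).isDiffTower_localDiff he).eqOn (S.target_subset_closure_interior e)
    (hf.isDiffTower_graph hU he hγ hg) (fun _ _ => sharp_apply hU hf hγ _) n

theorem localDiff_sharp_partialSnd_eqOn (hU : IsOpen U) (hf : IsSmoothProd S f U)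
    (he : e ∈ S.charts) {γ η : SmoothMap S E} (hγ : γ ∈ into S U)
    {g k : (n : ℕ) → IterTan n X → E} (hg : IsDiffTower (fun x => γ (e.invFun x)) e.target g)
    (hk : IsDiffTower (fun x => η (e.invFun x)) e.target k) (n : ℕ) :
    EqOn (localDiff e (sharp S (partialSnd S f U) (γ.prodMk η)) n)
      (fun w => iterDiff (chartRep e f) (e.target ×ˢ U) (n + 1)
        (zip n w (tanMap n g w), zip n (0 : IterTan n X) (tanMap n k w)))
      (tanOver e.target n) := by
  refine ((sharp S (partialSnd S f U) (γ.prodMk η)).isDiffTower_localDiff he).eqOn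
    (S.target_subset_closure_interior e)
    ((hf.isDiffTower he).comp_graph_partialSnd (S.target_subset_closure_interior e) hU hg hk
      fun x _ => hγ _) (fun x hx => ?_) n
  exact (sharp_apply (hU.prod isOpen_univ) (hf.partialSnd hU)
    (γ := γ.prodMk η) (fun m => ⟨hγ m, mem_univ _⟩) _).trans (hf.partialSnd_eq hU he hx (hγ _) _)

theorem tanMap_localDiff_mem (he : e ∈ S.charts) {γ : SmoothMap S E} (hγ : γ ∈ into S U) {n : ℕ}
    {w : IterTan n X} (hw : w ∈ tanOver e.target n) : tanMap n (localDiff e γ) w ∈ tanOver U n :=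
  tanMap_mem_tanOver (by
    rw [(γ.isDiffTower_localDiff he).zero]
    exact fun x _ => hγ _) n hw

/-- In a chart the n-th differential is dⁿf(w, Tⁿγ(w)): Tⁿγ(w) converges jointly in γ and w, and dⁿf
is continuous on its domain. -/
theorem continuousOn_sharp (hU : IsOpen U) (hf : IsSmoothProd S f U) :
    ContinuousOn (sharp S f) (into S U) := by
  intro γ hγ
  refine tendsto_of_eqOn fun e he n =>
    ⟨fun γ w => iterDiff (chartRep e f) (e.target ×ˢ U) n (zip n w (tanMap n (localDiff e γ) w)),
      fun w => iterDiff (chartRep e f) (e.target ×ˢ U) n (zip n w (tanMap n (localDiff e γ) w)),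
      eventually_nhdsWithin_of_forall fun η hη =>
        localDiff_sharp_eqOn hU hf he hη (η.isDiffTower_localDiff he) n,
      localDiff_sharp_eqOn hU hf he hγ (γ.isDiffTower_localDiff he) n, ?_⟩
  intro K hK hKA w₀ hw₀
  have hlim : Tendsto (fun p : SmoothMap S E × IterTan n X => tanMap n (localDiff e p.1) p.2)
      (𝓝[into S U] γ ×ˢ 𝓝[K] w₀) (𝓝 (tanMap n (localDiff e γ) w₀)) :=
    (tendsto_tanIter (T := SmoothMap S E) (h := fun η => localDiff e η)
      (fun k K hK hKA w₀ hw₀ => γ.tendsto_localDiff he k hK hKA hw₀) n 0 K hK hKA w₀ hw₀).mono_left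
      (Filter.prod_mono nhdsWithin_le_nhds le_rfl)
  refine ((hf.isDiffTower he).continuousOn n _ (zip_mem_tanOver n (hKA hw₀)
    (tanMap_localDiff_mem he hγ (hKA hw₀)))).tendsto.comp
    (f := fun p : SmoothMap S E × IterTan n X => zip n p.2 (tanMap n (localDiff e p.1) p.2))
    (tendsto_nhdsWithin_iff.2 ⟨?_, ?_⟩)
  · exact ((continuous_zip (E := X) (F := E) n).tendsto (w₀, tanMap n (localDiff e γ) w₀)).comp
      (((tendsto_snd.mono_right nhdsWithin_le_nhds).prodMk_nhds hlim))
  · filter_upwards [(eventually_mem_nhdsWithin (a := γ)).prod_mk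
      (eventually_mem_nhdsWithin (a := w₀))] with p hp
    exact zip_mem_tanOver n (hKA hp.2) (tanMap_localDiff_mem he hp.1 (hKA hp.2))

theorem localDiff_smul_sub (he : e ∈ S.charts) (γ η : SmoothMap S F) (t : ℝ) (n : ℕ)
    {w : IterTan n X} (hw : w ∈ tanOver e.target n) :
    localDiff e (t • (γ - η) : SmoothMap S F) n w =
      t • (localDiff e γ n w - localDiff e η n w) := by
  have h : chartDiffLinear S F ⟨e, he⟩ n (t • (γ - η)) =
      t • (chartDiffLinear S F ⟨e, he⟩ n γ - chartDiffLinear S F ⟨e, he⟩ n η) := by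
    rw [map_smul, map_sub]
  exact DFunLike.congr_fun h ⟨w, hw⟩

variable [T2Space M] [CompactSpace M]

/-- After taking n-th differentials, the quotient is one of dⁿf in its second variable, at Tⁿγ(w) in
direction Tⁿη(w). `tendsto_slope_snd` gives its limit jointly in w, and `comp_graph_partialSnd`
identifies that limit. Openness of C^∞(M, U) keeps γ + hη admissible for small h. -/
theorem tendsto_slope_sharp (hU : IsOpen U) (hf : IsSmoothProd S f U) {γ : SmoothMap S E}
    (hγ : γ ∈ into S U) (η : SmoothMap S E) :
    Tendsto (fun h : ℝ => h⁻¹ • (sharp S f (γ + h • η) - sharp S f γ)) (𝓝[≠] 0)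
      (𝓝 (sharp S (partialSnd S f U) (γ.prodMk η))) := by
  refine tendsto_of_eqOn fun e he n => ?_
  have hγt := γ.isDiffTower_localDiff he
  have hηt := η.isDiffTower_localDiff he
  refine ⟨fun h w => h⁻¹ • (iterDiff (chartRep e f) (e.target ×ˢ U) n
      (zip n w (tanMap n (localDiff e γ) w + h • tanMap n (localDiff e η) w)) -
      iterDiff (chartRep e f) (e.target ×ˢ U) n (zip n w (tanMap n (localDiff e γ) w))), _, ?_,
    localDiff_sharp_partialSnd_eqOn hU hf he hγ hγt hηt n, ?_⟩
  · filter_upwards [(tendsto_add_smul_nhds γ η).eventually_mem ((isOpen_into hU).mem_nhds hγ)]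
      with h hh w hw
    rw [localDiff_smul_sub he _ _ _ n hw, localDiff_sharp_eqOn hU hf he hγ hγt n hw,
      localDiff_sharp_eqOn hU hf he hh (hγt.add_smul hηt h) n hw]
    simp only [tanMap_add_smul]
  · intro K hK hKA w₀ hw₀
    have hT := S.target_subset_closure_interior e
    have h := (hf.isDiffTower he).tendsto_slope_snd hT hU (hKA hw₀)
      (tanMap_localDiff_mem he hγ (hKA hw₀)) (tanMap n (localDiff e η) w₀)
    refine h.comp (f := fun p : ℝ × IterTan n X =>
      (p.1, (p.2, (tanMap n (localDiff e γ) p.2, tanMap n (localDiff e η) p.2)))) ?_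
    have hc : ∀ {ζ : SmoothMap S E}, IsDiffTower (fun x => ζ (e.invFun x)) e.target
        (localDiff e ζ) → Tendsto (tanMap n (localDiff e ζ)) (𝓝[K] w₀)
        (𝓝 (tanMap n (localDiff e ζ) w₀)) := fun hζ =>
      (hζ.continuousOn_tanMap hT n w₀ (hKA hw₀)).mono hKA
    exact tendsto_fst.prodMk (((tendsto_id.mono_right (nhdsWithin_mono _ hKA)).prodMk
      ((hc hγt).prodMk (hc hηt))).comp tendsto_snd)

theorem hasDiffOn_sharp (hU : IsOpen U) (hf : IsSmoothProd S f U) :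
    HasDiffOn (sharp S f) (fun p => sharp S (partialSnd S f U) (p.1.prodMk p.2)) (into S U) where
  continuousOn := continuousOn_sharp hU hf
  tendsto _ hγ η := tendsto_slope_sharp hU hf (interior_subset hγ) η
  continuousOn_diff := (continuousOn_sharp (hU.prod isOpen_univ) (hf.partialSnd hU)).comp
    continuous_prodMk.continuousOn fun _ hp m => ⟨hp.1 m, mem_univ _⟩

end SmoothMap

/-! ### Higher differentials of `f_♯` -/

variable (S f U) in
/-- The iterated partial differentials `d₂ⁿf : M × (U × E^(2^n-1)) → F`. -/
noncomputable def iterPartialSnd : (n : ℕ) → M × IterTan n E → F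
  | 0 => f
  | n + 1 => partialSnd S (iterPartialSnd n) (tanOver U n)

theorem IsSmoothProd.iterPartialSnd (hU : IsOpen U) (hf : IsSmoothProd S f U) :
    (n : ℕ) → IsSmoothProd S (iterPartialSnd S f U n) (tanOver U n)
  | 0 => hf
  | n + 1 => (IsSmoothProd.iterPartialSnd hU hf n).partialSnd (isOpen_tanOver hU n)

/-- Induction on n: differentiating n times with each partial differential taken in its own chart
agrees with one differential in a fixed chart, since both are limits of the same quotients along E.
-/
theorem IsSmoothProd.iterPartialSnd_eq (hU : IsOpen U) (hf : IsSmoothProd S f U)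
    (he : e ∈ S.charts) {m : M} (hm : m ∈ e.source) : (n : ℕ) → {w : IterTan n E} →
    w ∈ tanOver U n → _root_.iterPartialSnd S f U n (m, w) = iterDiffSnd e f U n m w
  | 0, w, _ => (hf.iterDiffSnd_zero he hm w).symm
  | n + 1, w, hw => by
    refine tendsto_nhds_unique ((hf.iterPartialSnd hU n).tendsto_partialSnd (isOpen_tanOver hU n) m
      hw.1 w.2) ((hf.tendsto_iterDiffSnd hU he hm hw.1 w.2).congr' ?_)
    filter_upwards [(tendsto_add_smul_nhds w.1 w.2).eventually_mem
      ((isOpen_tanOver hU n).mem_nhds hw.1)] with h hh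
    rw [IsSmoothProd.iterPartialSnd_eq hU hf he hm n hh,
      IsSmoothProd.iterPartialSnd_eq hU hf he hm n hw.1]

namespace SmoothMap

variable (E S) in
/-- The identification of `T^n C^∞(M, E)` with `C^∞(M, T^n E)`. -/
noncomputable def collect : (n : ℕ) → IterTan n (SmoothMap S E) → SmoothMap S (IterTan n E)
  | 0, w => w
  | n + 1, w => (collect n w.1).prodMk (collect n w.2)

theorem collect_apply (x : M) : (n : ℕ) → (w : IterTan n (SmoothMap S E)) →
    collect E S n w x = IterTan.map (fun γ : SmoothMap S E => γ x) n w
  | 0, _ => rfl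
  | n + 1, w => Prod.ext (collect_apply x n w.1) (collect_apply x n w.2)

theorem collect_add_smul : (n : ℕ) → (w v : IterTan n (SmoothMap S E)) → (t : ℝ) →
    collect E S n (w + t • v) = collect E S n w + t • collect E S n v
  | 0, _, _, _ => rfl
  | n + 1, w, v, t => by
    show (collect E S n (w.1 + t • v.1)).prodMk (collect E S n (w.2 + t • v.2)) = _
    rw [collect_add_smul n, collect_add_smul n]
    rfl

theorem continuous_collect : (n : ℕ) → Continuous (collect E S n)
  | 0 => continuous_id
  | n + 1 => continuous_prodMk.comp (((continuous_collect n).comp continuous_fst).prodMk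
      ((continuous_collect n).comp continuous_snd))

theorem collect_mem_into : (n : ℕ) →
    MapsTo (collect E S n) (tanOver (into S U) n) (into S (tanOver U n))
  | 0, _, hw => hw
  | n + 1, _, hw => fun m => ⟨collect_mem_into n hw.1 m, mem_univ _⟩

variable [T2Space M] [CompactSpace M]

/-- Each step is `hasDiffOn_sharp` for the smooth map d₂ⁿf, precomposed with the continuous linear
map `collect`; the resulting differential is the next entry by definition. -/
theorem isDiffTower_sharp (hU : IsOpen U) (hf : IsSmoothProd S f U) :
    IsDiffTower (sharp S f) (into S U)
      (fun n w => sharp S (iterPartialSnd S f U n) (collect E S n w)) where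
  zero := rfl
  succ n := by
    have hUn := isOpen_tanOver hU n
    refine (hasDiffOn_sharp hUn (hf.iterPartialSnd hU n)).comp_linear (continuous_collect n)
      (collect_add_smul n) (collect_mem_into n) ?_
    rw [interior_tanOver, (isOpen_into hU).interior_eq, (isOpen_into hUn).interior_eq]
    exact collect_mem_into n

theorem iterDiff_sharp_apply (hU : IsOpen U) (hf : IsSmoothProd S f U) {n : ℕ}
    {w : IterTan n (SmoothMap S E)} (hw : w ∈ tanOver (into S U) n) (he : e ∈ S.charts) {x : M}
    (hx : x ∈ e.source) : iterDiff (sharp S f) (into S U) n w x =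
      iterDiffSnd e f U n x (IterTan.map (fun γ : SmoothMap S E => γ x) n w) := by
  have hV : into S U ⊆ closure (interior (into S U)) := by
    rw [(isOpen_into hU).interior_eq]; exact subset_closure
  have hc := collect_mem_into n hw
  rw [(isDiffTower_sharp hU hf).iterDiff_eqOn hV n hw,
    sharp_apply (isOpen_tanOver hU n) (hf.iterPartialSnd hU n) hc,
    hf.iterPartialSnd_eq hU he hx n (hc x), collect_apply]

/-- At each m the differential of f_♯ is d₂f(m, γ m, ·), which by uniqueness of limits is the
complex linear differential of f(m, ·). Linearity in C^∞(M, F) is pointwise. -/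
theorem holomorphicOn_sharp [Module ℂ E] [IsScalarTower ℝ ℂ E] [ContinuousSMul ℂ E]
    [Module ℂ F] [IsScalarTower ℝ ℂ F] [ContinuousSMul ℂ F] (hU : IsOpen U)
    (hf : IsSmoothProd S f U) (hh : ∀ m : M, HolomorphicOn (fun y => f (m, y)) U) :
    HolomorphicOn (sharp S f) (into S U) := by
  refine ⟨(isDiffTower_sharp hU hf).smoothOn, _, hasDiffOn_sharp hU hf, fun γ hγ => ?_⟩
  replace hγ := interior_subset hγ
  have happ (η : SmoothMap S E) (m : M) :
      sharp S (partialSnd S f U) (γ.prodMk η) m = partialSnd S f U (m, (γ m, η m)) :=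
    sharp_apply (hU.prod isOpen_univ) (hf.partialSnd hU) (γ := γ.prodMk η)
      (fun m => ⟨hγ m, mem_univ _⟩) m
  have hlin (m : M) : IsLinearMap ℂ fun v => partialSnd S f U (m, (γ m, v)) := by
    obtain ⟨-, f', hf', hl⟩ := hh m
    have hm : γ m ∈ interior U := by rw [hU.interior_eq]; exact hγ m
    have : (fun v => partialSnd S f U (m, (γ m, v))) = fun v => f' (γ m, v) := funext fun v =>
      tendsto_nhds_unique (hf.tendsto_partialSnd hU m (hγ m) v) (hf'.tendsto _ hm v)
    rw [this]
    exact hl _ hm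
  constructor
  · intro η ζ
    refine SmoothMap.ext fun m => ?_
    refine (happ _ m).trans (((hlin m).map_add (η m) (ζ m)).trans ?_)
    rw [← happ, ← happ]
    rfl
  · intro c η
    refine SmoothMap.ext fun m => ?_
    refine (happ _ m).trans (((hlin m).map_smul c (η m)).trans ?_)
    rw [← happ]
    rfl

theorem _root_.SmoothOn.isSmoothProd_snd {g : E → F} (hg : SmoothOn g U) :
    IsSmoothProd S (fun p : M × E => g p.2) U := fun e _ =>
  hg.comp_clm (ContinuousLinearMap.snd ℝ X E) (A := e.target ×ˢ U) (fun _ hp => hp.2)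
    (by rw [interior_prod_eq]; exact fun _ hp => hp.2)

end SmoothMap

end Sharp

theorem mainTheorem4
    {X M E F : Type*}
    [AddCommGroup X] [Module ℝ X] [TopologicalSpace X] [IsTopologicalAddGroup X]
    [ContinuousSMul ℝ X] [LocallyConvexSpace ℝ X] [T2Space X]
    [TopologicalSpace M] [T2Space M] [CompactSpace M]
    [AddCommGroup E] [Module ℝ E] [TopologicalSpace E] [IsTopologicalAddGroup E]
    [ContinuousSMul ℝ E] [LocallyConvexSpace ℝ E] [T2Space E]
    [AddCommGroup F] [Module ℝ F] [TopologicalSpace F] [IsTopologicalAddGroup F]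
    [ContinuousSMul ℝ F] [LocallyConvexSpace ℝ F] [T2Space F]
    (S : CornerStructure X M) (U : Set E) (hU : IsOpen U) :
    IsOpen (SmoothMap.into S U) ∧
    -- the map `f_♯` for smooth `f : M × U → F`
    (∀ f : M × E → F, IsSmoothProd S f U →
      (∀ γ ∈ SmoothMap.into S U, IsSmooth S fun x => f (x, γ x)) ∧
      SmoothOn (SmoothMap.sharp S f) (SmoothMap.into S U) ∧
      (∀ n : ℕ, ∀ w ∈ IterTan.tanOver (SmoothMap.into S U) n,
        ∀ e ∈ S.charts, ∀ x ∈ e.source,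
          iterDiff (SmoothMap.sharp S f) (SmoothMap.into S U) n w x =
            iterDiffSnd e f U n x (IterTan.map (fun γ : SmoothMap S E => γ x) n w)) ∧
      (∀ [Module ℂ E] [IsScalarTower ℝ ℂ E] [ContinuousSMul ℂ E]
        [Module ℂ F] [IsScalarTower ℝ ℂ F] [ContinuousSMul ℂ F],
        (∀ m : M, HolomorphicOn (fun y => f (m, y)) U) →
          HolomorphicOn (SmoothMap.sharp S f) (SmoothMap.into S U))) ∧
    -- the push-forward `g_*` for `g : U → F`
    (∀ g : E → F,
      (SmoothOn g U →
        (∀ γ ∈ SmoothMap.into S U, IsSmooth S fun x => g (γ x)) ∧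
        SmoothOn (SmoothMap.pushforward S g) (SmoothMap.into S U)) ∧
      (∀ [Module ℂ E] [IsScalarTower ℝ ℂ E] [ContinuousSMul ℂ E]
        [Module ℂ F] [IsScalarTower ℝ ℂ F] [ContinuousSMul ℂ F],
        HolomorphicOn g U →
          HolomorphicOn (SmoothMap.pushforward S g) (SmoothMap.into S U))) := by

  refine ⟨SmoothMap.isOpen_into hU, fun f hf => ⟨fun γ hγ => hf.isSmooth_graph hU hγ,
    (SmoothMap.isDiffTower_sharp hU hf).smoothOn,
    fun n w hw e he x hx => SmoothMap.iterDiff_sharp_apply hU hf hw he hx,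
    fun hh => SmoothMap.holomorphicOn_sharp hU hf hh⟩, fun g => ⟨fun hg => ⟨fun γ hγ =>
      hg.isSmoothProd_snd.isSmooth_graph hU hγ,
      -- `pushforward S g` unfolds to `sharp S` of the map p ↦ g p.2.
      (SmoothMap.isDiffTower_sharp hU hg.isSmoothProd_snd).smoothOn⟩,
    fun hg => SmoothMap.holomorphicOn_sharp hU hg.1.isSmoothProd_snd fun _ => hg⟩⟩
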